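/- Let $\mathbf x=(x_1,x_2,\dots)$, $\mathbf t=(t_1,t_2,\dots)$. For $f\in\mathbb Z[\mathbf t][\mathbf x]$ and $i\ge 1$ put $$R_i^-f=f(x_1,\dots,x_{i-1},t_i,x_i,x_{i+1},\dots;\mathbf t),\qquad R_i^+f=f(x_1,\dots,x_{i-1},x_i,t_i,x_{i+1},\dots;\mathbf t),\qquad E_if=\frac{R_i^+f-R_i^-f}{x_i-t_i}.$$ For $n\ge 0$ let $\mathrm{EQSym}_n$ be the $\mathbb Z[\mathbf t]$-algebra of equivariantly quasisymmetric polynomials, i.e. of those $f\in\mathbb Z[\mathbf t][x_1,\dots,x_n]$ with $R_i^+f=R_i^-f$ for $1\le i<n$. An indexed forest $F$ is a sequence $(T_1,T_2,\dots)$ of binary plane trees, all but finitely many of which consist of a single leaf; $\emptyset$ is the forest all of whose trees are single leaves. The leaves of $F$ are labelled $1,2,3,\dots$ from left to right. For an internal node $v$ let $\rho_F(v)$ be the label of the leaf reached from $v$ by going down left edges. The code of $F$ is the sequence $(c_i)_{i\ge1}$, $c_i=\#\{v:\rho_F(v)=i\}$. Let $\mathrm{QDes}(F)=\{\rho_F(v):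 v\text{ an internal node both of whose children are leaves}\}$, and for $i\in \mathrm{QDes}(F)$ let $F/i$ be the forest obtained by replacing the node $v$ with both children leaves and $\rho_F(v)=i$ by a leaf. Let $\mathrm{Zig}_n$ be the set of zigzag forests, those with $\mathrm{QDes}(F)\subseteq\{n\}$ (so $\mathrm{Zig}_0=\{\emptyset\}$). The double forest polynomials $\mathfrak P_F(\mathbf x;\mathbf t)$ are the unique family of homogeneous polynomials in $\mathbb Z[\mathbf t][\mathbf x]$, indexed by the indexed forests $F$, with $\mathfrak P_\emptyset(\mathbf t;\mathbf t)=1$, $\mathfrak P_F(\mathbf t;\mathbf t)=0$ for $F\neq\emptyset$, and $E_i\mathfrak P_F=\mathfrak P_{F/i}(\mathbf x;t_1,\dots,t_{i-1},t_{i+1},\dots)$ if $i\in\mathrm{QDes}(F)$, $E_i\mathfrak P_F=0$ otherwise. A padded composition of length $n$ is a sequence $c=(0^{n-\ell},a_1,\dots,a_\ell)$ with $0\le\ell\le n$ and all $a_j>0$. Let $F_c$ be the unique indexed forest whose code is $c$ followed by zeros. Let $\mathfrak F_c(\mathbf x_n;\mathbf t)=\mathfrak P_{F_c}(\mathbf x;\mathbf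 t)$ be the double fundamental quasisymmetric polynomial. With $m=a_1+\dots+a_\ell$ and $\mathrm{Set}(c)=\{a_1,a_1+a_2,\dots,a_1+\dots+a_{\ell-1}\}$, the ordinary fundamental quasisymmetric polynomial is $$\mathfrak F_c(\mathbf x_n)=\sum_{\substack{1\le i_1\le\dots\le i_m\le n\\ j\in\mathrm{Set}(c)\Rightarrow i_j<i_{j+1}}}x_{i_1}\cdots x_{i_m}.$$ **Theorem.** The family $(\mathfrak P_F)_F$ exists and is unique, and for every padded composition $c$ the forest $F_c$ exists and is unique. For every $n\ge0$: 1. $\mathfrak F_c(\mathbf x_n;\mathbf 0)=\mathfrak F_c(\mathbf x_n)$ for every padded composition $c$ of length $n$; 2. $\{\mathfrak P_F(\mathbf x;\mathbf t): F\in\mathrm{Zig}_n\}=\{\mathfrak F_c(\mathbf x_n;\mathbf t): c\text{ a padded composition of length } n\}$, and this set is a $\mathbb Z[\mathbf t]$-basis of $\mathrm{EQSym}_n$: each of the families $(\mathfrak P_F)_{F\in\mathrm{Zig}_n}$ and $(\mathfrak F_c)_c$ is a basis. -/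

import Mathlib

noncomputable section

namespace EQSymPoly

open MvPolynomial

/-! Indexing convention: all the index sets that are written `1, 2, 3, …` on paper are `0, 1, 2, …`
here.  Thus `X i` is the variable `x_{i+1}`, `tvar i` is `t_{i+1}`, leaf `i` of a forest is the leaf
labelled `i + 1`, and the operators with index `i` are those with index `i + 1` on paper. -/

/-- The coefficient ring `ℤ[t]`, `t = (t₁, t₂, …)`. -/
abbrev CoeffT : Type := MvPolynomial ℕ ℤ

/-- The polynomial ring `ℤ[t][x]`, `x = (x₁, x₂, …)`, `t = (t₁, t₂, …)`. -/
abbrev PolyTX : Type := MvPolynomial ℕ CoeffT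

/-- The equivariant variable `t_{i+1}`, as an element of `ℤ[t]`. -/
def tvar (i : ℕ) : CoeffT := X i

/-! ### Equivariantly quasisymmetric polynomials -/

/-- The equivariant Bergeron–Sottile map `R_i^-`:
`f(x; t) ↦ f(x_1, …, x_{i-1}, t_i, x_i, x_{i+1}, …; t)`. -/
def rMinus (i : ℕ) : PolyTX →ₐ[CoeffT] PolyTX :=
  aeval fun j => if j < i then X j else if j = i then C (tvar i) else X (j - 1)

/-- The equivariant Bergeron–Sottile map `R_i^+`:
`f(x; t) ↦ f(x_1, …, x_{i-1}, x_i, t_i, x_{i+1}, …; t)`. -/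
def rPlus (i : ℕ) : PolyTX →ₐ[CoeffT] PolyTX :=
  aeval fun j => if j ≤ i then X j else if j = i + 1 then C (tvar i) else X (j - 1)

/-- The `ℤ[t]`-algebra `EQSym_n` of equivariantly quasisymmetric polynomials: those
`f ∈ ℤ[t][x_1, …, x_n]` with `R_i^+ f = R_i^- f` for `1 ≤ i < n`. -/
def eqsym (n : ℕ) : Subalgebra CoeffT PolyTX where
  carrier := {f | f ∈ supported CoeffT {i : ℕ | i < n} ∧
    ∀ i : ℕ, i + 1 < n → rPlus i f = rMinus i f}
  mul_mem' := fun ha hb =>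
    ⟨mul_mem ha.1 hb.1, fun i hi => by rw [map_mul, map_mul, ha.2 i hi, hb.2 i hi]⟩
  add_mem' := fun ha hb =>
    ⟨add_mem ha.1 hb.1, fun i hi => by rw [map_add, map_add, ha.2 i hi, hb.2 i hi]⟩
  algebraMap_mem' := fun r =>
    ⟨Subalgebra.algebraMap_mem _ r, fun i _ => by rw [AlgHom.commutes, AlgHom.commutes]⟩

theorem sub_dvd_rPlus_sub_rMinus (i : ℕ) (f : PolyTX) :
    (X i - C (tvar i) : PolyTX) ∣ rPlus i f - rMinus i f := by
  rw [← Ideal.mem_span_singleton, ← Ideal.Quotient.mk_eq_mk_iff_sub_mem]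
  have hx : Ideal.Quotient.mk (Ideal.span {(X i - C (tvar i) : PolyTX)}) (X i) =
      Ideal.Quotient.mk (Ideal.span {(X i - C (tvar i) : PolyTX)}) (C (tvar i)) := by
    rw [Ideal.Quotient.mk_eq_mk_iff_sub_mem, Ideal.mem_span_singleton]
  have h : (Ideal.Quotient.mkₐ CoeffT (Ideal.span {(X i - C (tvar i) : PolyTX)})).comp (rPlus i) =
      (Ideal.Quotient.mkₐ CoeffT (Ideal.span {(X i - C (tvar i) : PolyTX)})).comp (rMinus i) := by
    apply MvPolynomial.algHom_ext
    intro j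
    simp only [AlgHom.comp_apply, rPlus, rMinus, aeval_X, Ideal.Quotient.mkₐ_eq_mk]
    rcases lt_trichotomy j i with hj | hj | hj
    · rw [if_pos hj.le, if_pos hj]
    · subst hj
      simpa using hx
    · rw [if_neg (show ¬ j ≤ i by omega), if_neg (show ¬ j < i by omega),
        if_neg (show ¬ j = i by omega)]
      by_cases h1 : j = i + 1
      · rw [if_pos h1, h1, Nat.add_sub_cancel]
        exact hx.symm
      · rw [if_neg h1]
  exact DFunLike.congr_fun h f

/-- The equivariant trimming operation (equivariant quasisymmetric divided difference)
`E_i f = (R_i^+ f - R_i^- f) / (x_i - t_i)`; the quotient is unique as `ℤ[t][x]` is a domain. -/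
def eope (i : ℕ) (f : PolyTX) : PolyTX := Classical.choose (sub_dvd_rPlus_sub_rMinus i f)

theorem eope_spec (i : ℕ) (f : PolyTX) :
    (X i - C (tvar i)) * eope i f = rPlus i f - rMinus i f :=
  (Classical.choose_spec (sub_dvd_rPlus_sub_rMinus i f)).symm

/-! ### Indexed forests

A binary plane tree is a `BinaryTree Unit`: `nil` is the trivial tree (a single leaf), and
`node () l r` is an internal node with left subtree `l` and right subtree `r`. -/

/-- The values `ρ(v)` of the flag (the label of the leaf reached from `v` by going down left edges)
over all internal nodes `v` of a tree whose leaves are labelled `o, o + 1, …` from left to right. -/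
def treeFlags : ℕ → BinaryTree Unit → Multiset ℕ
  | _, .nil => 0
  | o, .node _ l r => o ::ₘ (treeFlags o l + treeFlags (o + l.numLeaves) r)

/-- The values of the flag over the terminal nodes (both children are leaves) only. -/
def treeTerminalFlags : ℕ → BinaryTree Unit → Set ℕ
  | _, .nil => ∅
  | o, .node _ l r =>
    if l = .nil ∧ r = .nil then {o}
    else treeTerminalFlags o l ∪ treeTerminalFlags (o + l.numLeaves) r

/-- Delete (that is, turn into a leaf) the terminal node with flag value `i`, if there is one, in a
tree whose leaves are labelled `o, o + 1, …`. -/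
def treeTrim (i : ℕ) : ℕ → BinaryTree Unit → BinaryTree Unit
  | _, .nil => .nil
  | o, .node a l r =>
    if l = .nil ∧ r = .nil then (if o = i then .nil else .node a l r)
    else .node a (treeTrim i o l) (treeTrim i (o + l.numLeaves) r)

/-- An indexed forest: an infinite sequence of binary plane trees, all but finitely many trivial. -/
@[ext] structure IndexedForest where
  trees : ℕ → BinaryTree Unit
  finite_nontrivial : {k | trees k ≠ .nil}.Finite

namespace IndexedForest

/-- The empty forest, all of whose trees are trivial. -/
def empty : IndexedForest := ⟨fun _ => .nil, by simp⟩

instance : Inhabited IndexedForest := ⟨empty⟩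

/-- The label of the leftmost leaf of the `k`-th tree, when the leaves of the forest are labelled
`0, 1, 2, …` from left to right. -/
def firstLeaf (F : IndexedForest) (k : ℕ) : ℕ := ∑ j ∈ Finset.range k, (F.trees j).numLeaves

/-- The code: `c_i` is the number of internal nodes `v` of `F` with `ρ_F(v) = i`.  All the leaves of
the `k`-th tree have labels `≥ k`, so only the trees with `k ≤ i` contribute to `c_i`. -/
def code (F : IndexedForest) (i : ℕ) : ℕ :=
  ∑ k ∈ Finset.range (i + 1), (treeFlags (F.firstLeaf k) (F.trees k)).count i

/-- `QDes(F) = {ρ_F(v) | v a terminal node of F}`. -/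
def qdes (F : IndexedForest) : Set ℕ :=
  {i | ∃ k, i ∈ treeTerminalFlags (F.firstLeaf k) (F.trees k)}

/-- The trimmed forest `F/i` (used for `i ∈ QDes(F)`): delete the terminal node with flag `i`. -/
def trim (F : IndexedForest) (i : ℕ) : IndexedForest where
  trees k := treeTrim i (F.firstLeaf k) (F.trees k)
  finite_nontrivial := F.finite_nontrivial.subset fun k hk h => hk (by rw [h, treeTrim])

end IndexedForest

/-- The zigzag forests `Zig_n`: the forests with `QDes(F) ⊆ {n}` (labels starting from `1`). -/
def zigzag (n : ℕ) : Set IndexedForest := {F | ∀ i ∈ F.qdes, i + 1 = n}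

/-! ### Double forest polynomials -/

/-- The specialization `f(t; t) ∈ ℤ[t]` of `f(x; t)` at `x_i = t_i`. -/
def evalXT : PolyTX →ₐ[CoeffT] CoeffT := aeval tvar

/-- `f(x; t) ↦ f(x; t̂_i)`, where `t̂_i = (t_1, …, t_{i-1}, t_{i+1}, …)`. -/
def omitT (i : ℕ) : PolyTX →+* PolyTX :=
  map (rename (fun j => if j < i then j else j + 1) : CoeffT →ₐ[ℤ] CoeffT).toRingHom

/-- Homogeneity with respect to the total degree in all the variables `x` and `t` together. -/
def IsHomogeneousTX (f : PolyTX) : Prop :=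
  ∃ d : ℕ, ((sumAlgEquiv ℤ ℕ ℕ).symm f).IsHomogeneous d

/-- The characterization of the family of double forest polynomials. -/
structure IsDoubleForestFamily (P : IndexedForest → PolyTX) : Prop where
  homogeneous : ∀ F, IsHomogeneousTX (P F)
  normalized_empty : evalXT (P IndexedForest.empty) = 1
  normalized : ∀ F, F ≠ IndexedForest.empty → evalXT (P F) = 0
  eope_of_mem : ∀ F, ∀ i ∈ F.qdes, eope i (P F) = omitT i (P (F.trim i))
  eope_of_notMem : ∀ F, ∀ i ∉ F.qdes, eope i (P F) = 0

/-- The double forest polynomials `𝔓_F(x; t)`: the family with the above properties. -/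
def doubleForest : IndexedForest → PolyTX := Classical.epsilon IsDoubleForestFamily

/-! ### Padded compositions and (double) fundamental quasisymmetric polynomials -/

/-- The padded compositions of length `n`: sequences `(0^m, a_1, …, a_{n-m})` with all `a_i > 0`. -/
def padded (n : ℕ) : Set (Fin n → ℕ) := {c | ∃ m ≤ n, ∀ i : Fin n, 0 < c i ↔ m ≤ (i : ℕ)}

/-- Append zeros to a finite sequence, to get an infinite sequence. -/
def appendZeros {n : ℕ} (c : Fin n → ℕ) : ℕ → ℕ := fun i => if h : i < n then c ⟨i, h⟩ else 0

/-- The indexed forest `F_c` whose code is `c` (with zeros appended). -/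
def forestOf {n : ℕ} (c : Fin n → ℕ) : IndexedForest :=
  Classical.epsilon fun F => F.code = appendZeros c

/-- The double fundamental quasisymmetric polynomial `𝔉_c(x_n; t) = 𝔓_{F_c}(x_n; t)`. -/
def doubleFundamental {n : ℕ} (c : Fin n → ℕ) : PolyTX := doubleForest (forestOf c)

/-- For `c = (0^{n-ℓ}, a_1, …, a_ℓ)`, the set `{a_1, a_1 + a_2, …, a_1 + ⋯ + a_{ℓ-1}}`. -/
def partialSums {n : ℕ} (c : Fin n → ℕ) : Set ℕ :=
  {s | ∃ k : Fin n, 0 < c k ∧ (k : ℕ) + 1 < n ∧ s = ∑ j ∈ Finset.Iic k, c j}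

open Classical in
/-- The ordinary fundamental quasisymmetric polynomial: the sum of `x_{i_1} ⋯ x_{i_m}` over all
`1 ≤ i_1 ≤ ⋯ ≤ i_m ≤ n` such that `i_j < i_{j+1}` for all `j ∈ Set(c)`, where `m = ∑ c`.
Below `p` and `q` are adjacent positions: they are the positions `j` and `j + 1`, where `j = q`
as positions are counted from `0`. -/
def fundamental {n : ℕ} (c : Fin n → ℕ) : MvPolynomial ℕ ℤ :=
  ∑ i : Fin (∑ k, c k) → Fin n with
      Monotone i ∧ ∀ p q : Fin (∑ k, c k), (p : ℕ) + 1 = q → (q : ℕ) ∈ partialSums c → i p < i q,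
    ∏ j, X (i j : ℕ)

/-- The specialization `f(x; t) ↦ f(x; 0)`. -/
def specializeZero : PolyTX →+* MvPolynomial ℕ ℤ := map (eval (fun _ => 0))

end EQSymPoly

end

open EQSymPoly

/-!
Iterating divided differences and then setting `x = t` gives, for every forest, a linear functional
on `ℤ[t][x]`.  These functionals separate polynomials, since a polynomial all of whose divided
differences vanish is constant, and only finitely many of them are nonzero on a given polynomial.
Conversely, polynomials `gᵢ`, almost all zero, are the divided differences `Eᵢ f` of some `f` as
soon as they satisfy the commutation relations of the `Eᵢ`.  By induction on the number of internal
nodes this produces a basis dual to the functionals: the double forest polynomials.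

A polynomial lies in `EQSymₙ` exactly when `Eᵢ` kills it for all `i ≠ n`, that is, when only those
forests occur in it that cannot be trimmed away from leaf `n`: the zigzag forests, whose codes are
the padded compositions of length `n`.  At `t = 0` the fundamental quasisymmetric polynomials
satisfy the recursion that determines the forest polynomials.
-/

noncomputable section

namespace EQSymPoly

open MvPolynomial

/-! ### Insertion of scalars and divided differences -/

/-- The increasing enumeration of `ℕ` without `i`; precomposing a sequence with it omits the entry
with index `i`. -/
def skip (i j : ℕ) : ℕ := if j < i then j else j + 1

theorem skip_injective (i : ℕ) : Function.Injective (skip i) := by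
  intro a b h
  grind [skip]

theorem skip_comp_skip {i j : ℕ} (h : j < i) : skip j ∘ skip i = skip (i + 1) ∘ skip j := by
  funext k
  grind [skip]

section DividedDifferences

variable {R S : Type*} [CommRing R] [CommRing S]

/-- The insertion of the scalar `y` in position `i`: `f(x) ↦ f(x₀, …, xᵢ₋₁, y, xᵢ, xᵢ₊₁, …)`.  The
Bergeron–Sottile maps `R_i^-` and `R_i^+` insert `tᵢ` in the positions `i` and `i + 1`. -/
def insertAt (y : R) (i : ℕ) : MvPolynomial ℕ R →ₐ[R] MvPolynomial ℕ R :=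
  aeval fun j => if j < i then X j else if j = i then C y else X (j - 1)

theorem insertAt_C (y : R) (i : ℕ) (a : R) : insertAt y i (C a) = C a := (insertAt y i).commutes a

theorem insertAt_X_of_lt (y : R) {i j : ℕ} (h : j < i) : insertAt y i (X j) = X j := by
  simp [insertAt, h]

theorem insertAt_X_self (y : R) (i : ℕ) : insertAt y i (X i) = C y := by
  simp [insertAt]

theorem insertAt_X_of_gt (y : R) {i j : ℕ} (h : i < j) : insertAt y i (X j) = X (j - 1) := by
  simp [insertAt, h.not_gt, h.ne']

theorem rMinus_eq_insertAt (i : ℕ) : rMinus i = insertAt (tvar i) i := rfl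

theorem rPlus_eq_insertAt (i : ℕ) : rPlus i = insertAt (tvar i) (i + 1) :=
  algHom_ext fun j => by simp [rPlus, insertAt]

theorem insertAt_insertAt (y z : R) {i j : ℕ} (h : i ≤ j) (f : MvPolynomial ℕ R) :
    insertAt y i (insertAt z (j + 1) f) = insertAt z j (insertAt y i f) := by
  suffices (insertAt y i).comp (insertAt z (j + 1)) = (insertAt z j).comp (insertAt y i) from
    DFunLike.congr_fun this f
  refine algHom_ext fun k => ?_
  simp only [AlgHom.comp_apply]
  rcases lt_trichotomy k i with hk | rfl | hk
  · rw [insertAt_X_of_lt z (by omega), insertAt_X_of_lt y hk, insertAt_X_of_lt z (by omega)]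
  · rw [insertAt_X_of_lt z (by omega), insertAt_X_self, insertAt_C]
  rw [insertAt_X_of_gt y hk]
  rcases lt_trichotomy k (j + 1) with hk' | rfl | hk'
  · rw [insertAt_X_of_lt z hk', insertAt_X_of_gt y hk, insertAt_X_of_lt z (by omega)]
  · rw [insertAt_X_self, insertAt_C, Nat.add_sub_cancel, insertAt_X_self]
  · rw [insertAt_X_of_gt z hk', insertAt_X_of_gt y (by omega), insertAt_X_of_gt z (by omega)]

theorem map_insertAt (σ : R →+* S) (y : R) (i : ℕ) (f : MvPolynomial ℕ R) :
    map σ (insertAt y i f) = insertAt (σ y) i (map σ f) := by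
  suffices (map σ).comp (insertAt y i : MvPolynomial ℕ R →+* MvPolynomial ℕ R) =
      (insertAt (σ y) i : MvPolynomial ℕ S →+* MvPolynomial ℕ S).comp (map σ) from
    DFunLike.congr_fun this f
  refine ringHom_ext (fun a => by simp) fun j => ?_
  simp only [RingHom.comp_apply, RingHom.coe_coe, map_X]
  rcases lt_trichotomy j i with h | rfl | h
  · rw [insertAt_X_of_lt _ h, insertAt_X_of_lt _ h, map_X]
  · rw [insertAt_X_self, insertAt_X_self, map_C]
  · rw [insertAt_X_of_gt _ h, insertAt_X_of_gt _ h, map_X]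

theorem insertAt_eq_self (y : R) {n i : ℕ} (h : n ≤ i) {f : MvPolynomial ℕ R}
    (hf : f ∈ supported R (Set.Iio n)) : insertAt y i f = f := by
  suffices supported R (Set.Iio n) ≤
      AlgHom.equalizer (insertAt y i) (AlgHom.id R (MvPolynomial ℕ R)) from
    (AlgHom.mem_equalizer _ _ _).1 (this hf)
  rw [supported_eq_adjoin_X, Algebra.adjoin_le_iff]
  rintro _ ⟨j, hj, rfl⟩
  exact insertAt_X_of_lt y (lt_of_lt_of_le hj h)

theorem insertAt_mem_supported (y : R) (n : ℕ) {f : MvPolynomial ℕ R}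
    (hf : f ∈ supported R (Set.Iio (n + 1))) : insertAt y n f ∈ supported R (Set.Iio n) := by
  suffices supported R (Set.Iio (n + 1)) ≤ (supported R (Set.Iio n)).comap (insertAt y n) from
    this hf
  rw [supported_eq_adjoin_X, Algebra.adjoin_le_iff]
  rintro _ ⟨j, hj, rfl⟩
  change insertAt y n (X j) ∈ supported R (Set.Iio n)
  rcases (Nat.lt_succ_iff.1 hj).lt_or_eq with h | rfl
  · rw [insertAt_X_of_lt y h]
    exact Algebra.subset_adjoin ⟨j, h, rfl⟩
  · rw [insertAt_X_self]
    exact Subalgebra.algebraMap_mem _ y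

theorem exists_mem_supported_Iio (f : MvPolynomial ℕ R) : ∃ n, f ∈ supported R (Set.Iio n) := by
  obtain ⟨n, hn⟩ := f.vars.bddAbove
  exact ⟨n + 1, mem_supported.2 fun j hj => Nat.lt_succ_of_le (hn hj)⟩

theorem totalDegree_insertAt_le (y : R) (i : ℕ) (f : MvPolynomial ℕ R) :
    (insertAt y i f).totalDegree ≤ f.totalDegree := by
  rcases subsingleton_or_nontrivial R with _ | _
  · simp [Subsingleton.elim (insertAt y i f) 0]
  rw [insertAt, aeval_def, eval₂_eq]
  refine totalDegree_finsetSum_le fun d hd => ?_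
  refine (totalDegree_mul _ _).trans ?_
  rw [algebraMap_eq, totalDegree_C, zero_add]
  refine (totalDegree_finsetProd _ _).trans ?_
  refine le_trans (Finset.sum_le_sum fun j _ => ?_) (le_totalDegree hd)
  refine (totalDegree_pow _ _).trans ?_
  suffices (if j < i then X j else if j = i then C y else X (j - 1) :
      MvPolynomial ℕ R).totalDegree ≤ 1 by simpa using Nat.mul_le_mul_left (d j) this
  split_ifs <;> simp

theorem X_sub_C_dvd_insertAt_sub (y : R) (i : ℕ) (f : MvPolynomial ℕ R) :
    X i - C y ∣ insertAt y (i + 1) f - insertAt y i f := by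
  rw [← Ideal.mem_span_singleton, ← Ideal.Quotient.mk_eq_mk_iff_sub_mem]
  set I : Ideal (MvPolynomial ℕ R) := Ideal.span {X i - C y}
  have hX : Ideal.Quotient.mk I (X i) = Ideal.Quotient.mk I (C y) :=
    (Ideal.Quotient.mk_eq_mk_iff_sub_mem _ _).2 (Ideal.mem_span_singleton_self _)
  suffices (Ideal.Quotient.mkₐ R I).comp (insertAt y (i + 1)) =
      (Ideal.Quotient.mkₐ R I).comp (insertAt y i) from DFunLike.congr_fun this f
  refine algHom_ext fun j => ?_
  simp only [AlgHom.comp_apply, Ideal.Quotient.mkₐ_eq_mk]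
  rcases lt_trichotomy j i with hj | rfl | hj
  · rw [insertAt_X_of_lt _ hj, insertAt_X_of_lt _ (by omega)]
  · rw [insertAt_X_of_lt _ (by omega), insertAt_X_self, hX]
  rw [insertAt_X_of_gt _ hj]
  rcases (Nat.succ_le_of_lt hj).eq_or_lt with rfl | hj'
  · rw [insertAt_X_self, Nat.succ_sub_one, hX]
  · rw [insertAt_X_of_gt _ hj']

theorem X_sub_C_ne_zero [Nontrivial R] (y : R) (i : ℕ) : (X i - C y : MvPolynomial ℕ R) ≠ 0 :=
  fun h => by simpa using congrArg (eval fun _ => y + 1) h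

theorem one_le_totalDegree_X_sub_C [Nontrivial R] (y : R) (i : ℕ) :
    1 ≤ (X i - C y : MvPolynomial ℕ R).totalDegree := by
  have := totalDegree_add (X i - C y) (C y)
  rwa [sub_add_cancel, totalDegree_X, totalDegree_C, Nat.max_zero] at this

variable [IsDomain R] [IsDomain S]

/-- The divided difference `f ↦ (f(…, xᵢ, y, xᵢ₊₁, …) - f(…, y, xᵢ, xᵢ₊₁, …)) / (xᵢ - y)`, of which
the trimming operation `E_i` is the case `y = tᵢ`. -/
def divDiff (y : R) (i : ℕ) : MvPolynomial ℕ R →ₗ[R] MvPolynomial ℕ R where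
  toFun f := Classical.choose (X_sub_C_dvd_insertAt_sub y i f)
  map_add' f g := by
    apply mul_left_cancel₀ (X_sub_C_ne_zero y i)
    rw [mul_add]
    iterate 3 rw [← Classical.choose_spec (X_sub_C_dvd_insertAt_sub y i _)]
    simp only [map_add]
    ring
  map_smul' a f := by
    apply mul_left_cancel₀ (X_sub_C_ne_zero y i)
    rw [RingHom.id_apply, mul_smul_comm]
    iterate 2 rw [← Classical.choose_spec (X_sub_C_dvd_insertAt_sub y i _)]
    simp only [map_smul, smul_sub]

theorem X_sub_C_mul_divDiff (y : R) (i : ℕ) (f : MvPolynomial ℕ R) :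
    (X i - C y) * divDiff y i f = insertAt y (i + 1) f - insertAt y i f :=
  (Classical.choose_spec (X_sub_C_dvd_insertAt_sub y i f)).symm

theorem divDiff_eq_of_mul_eq {y : R} {i : ℕ} {f g : MvPolynomial ℕ R}
    (h : (X i - C y) * g = insertAt y (i + 1) f - insertAt y i f) : divDiff y i f = g :=
  mul_left_cancel₀ (X_sub_C_ne_zero y i) ((X_sub_C_mul_divDiff y i f).trans h.symm)

theorem eope_eq_divDiff (i : ℕ) (f : PolyTX) : eope i f = divDiff (tvar i) i f :=
  (divDiff_eq_of_mul_eq (by rw [eope_spec, rPlus_eq_insertAt, rMinus_eq_insertAt])).symm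

theorem divDiff_eq_zero_iff {y : R} {i : ℕ} {f : MvPolynomial ℕ R} :
    divDiff y i f = 0 ↔ insertAt y (i + 1) f = insertAt y i f := by
  rw [← sub_eq_zero (a := insertAt y (i + 1) f), ← X_sub_C_mul_divDiff, mul_eq_zero,
    or_iff_right (X_sub_C_ne_zero y i)]

theorem divDiff_C (y : R) (i : ℕ) (a : R) : divDiff y i (C a) = 0 :=
  divDiff_eq_zero_iff.2 (by rw [insertAt_C, insertAt_C])

theorem divDiff_comm (y z : R) {i j : ℕ} (h : j < i) (f : MvPolynomial ℕ R) :
    divDiff z i (divDiff y j f) = divDiff y j (divDiff z (i + 1) f) := by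
  apply mul_left_cancel₀ (X_sub_C_ne_zero z i)
  apply mul_left_cancel₀ (X_sub_C_ne_zero y j)
  have h1 := congrArg (insertAt z (i + 1)) (X_sub_C_mul_divDiff y j f)
  have h2 := congrArg (insertAt z i) (X_sub_C_mul_divDiff y j f)
  have h3 := congrArg (insertAt y (j + 1)) (X_sub_C_mul_divDiff z (i + 1) f)
  have h4 := congrArg (insertAt y j) (X_sub_C_mul_divDiff z (i + 1) f)
  simp only [map_mul, map_sub, insertAt_C] at h1 h2 h3 h4
  rw [insertAt_X_of_lt z (by omega), ← insertAt_insertAt y z (by omega),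
    ← insertAt_insertAt y z (by omega)] at h1 h2
  rw [insertAt_X_of_gt y (by omega), Nat.add_sub_cancel] at h3 h4
  linear_combination (X j - C y) * X_sub_C_mul_divDiff z i (divDiff y j f) + h1 - h2 -
    (X i - C z) * X_sub_C_mul_divDiff y j (divDiff z (i + 1) f) - h3 + h4

theorem map_divDiff (σ : R →+* S) (y : R) (i : ℕ) (f : MvPolynomial ℕ R) :
    map σ (divDiff y i f) = divDiff (σ y) i (map σ f) :=
  (divDiff_eq_of_mul_eq
    (by simpa [map_insertAt] using congrArg (map σ) (X_sub_C_mul_divDiff y i f))).symm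

theorem totalDegree_divDiff_lt (y : R) (i : ℕ) {f : MvPolynomial ℕ R} (h : divDiff y i f ≠ 0) :
    (divDiff y i f).totalDegree < f.totalDegree := by
  have hmul := congrArg totalDegree (X_sub_C_mul_divDiff y i f)
  rw [totalDegree_mul_of_isDomain (X_sub_C_ne_zero y i) h] at hmul
  have hsub := totalDegree_sub (insertAt y (i + 1) f) (insertAt y i f)
  have hmax := max_le (totalDegree_insertAt_le y (i + 1) f) (totalDegree_insertAt_le y i f)
  have := one_le_totalDegree_X_sub_C y i
  omega

theorem divDiff_eq_zero_of_supported (y : R) {n i : ℕ} (h : n ≤ i) {f : MvPolynomial ℕ R}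
    (hf : f ∈ supported R (Set.Iio n)) : divDiff y i f = 0 :=
  divDiff_eq_zero_iff.2 (by rw [insertAt_eq_self y h hf, insertAt_eq_self y (by omega) hf])

theorem mem_supported_of_divDiff (τ : ℕ → R) {n : ℕ} {f : MvPolynomial ℕ R}
    (hf : ∀ i, n ≤ i → divDiff (τ i) i f = 0) : f ∈ supported R (Set.Iio n) := by
  obtain ⟨N, hN⟩ := exists_mem_supported_Iio f
  have hdescent : ∀ k, f ∈ supported R (Set.Iio (n + k)) → f ∈ supported R (Set.Iio n) := by
    intro k
    induction k with
    | zero => exact id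
    | succ k ih =>
      intro h
      have hins := divDiff_eq_zero_iff.1 (hf (n + k) (by omega))
      rw [insertAt_eq_self _ (by omega) h] at hins
      exact ih (hins ▸ insertAt_mem_supported _ _ h)
  exact hdescent N (supported_mono (Set.Iio_subset_Iio (by omega)) hN)

theorem eq_C_aeval_of_divDiff_eq_zero (τ : ℕ → R) {f : MvPolynomial ℕ R}
    (hf : ∀ i, divDiff (τ i) i f = 0) : f = C (aeval τ f) := by
  have h := mem_supported_of_divDiff τ (n := 0) fun i _ => hf i
  rw [show Set.Iio 0 = (∅ : Set ℕ) from Set.Iio_bot, supported_empty] at h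
  obtain ⟨a, rfl⟩ := Algebra.mem_bot.1 h
  simp [algebraMap_eq]

theorem ext_divDiff (τ : ℕ → R) {f g : MvPolynomial ℕ R} (h : aeval τ f = aeval τ g)
    (hd : ∀ i, divDiff (τ i) i f = divDiff (τ i) i g) : f = g := by
  have := eq_C_aeval_of_divDiff_eq_zero τ (f := f - g) fun i => by rw [map_sub, hd, sub_self]
  rwa [map_sub, h, sub_self, C_0, sub_eq_zero] at this

end DividedDifferences

/-! ### Codes and grafting -/

theorem multiset_induction_on_max {p : Multiset ℕ → Prop} (c : Multiset ℕ) (zero : p 0)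
    (cons : ∀ k d, (∀ j ∈ d, j ≤ k) → p d → p (k ::ₘ d)) : p c := by
  induction c using Multiset.strongInductionOn with
  | ih c ih =>
    rcases c.empty_or_exists_mem with rfl | ⟨j, hj⟩
    · exact zero
    obtain ⟨k, hk, hmax⟩ := c.toFinset.exists_max_image id ⟨j, Multiset.mem_toFinset.2 hj⟩
    rw [Multiset.mem_toFinset] at hk
    rw [← Multiset.cons_erase hk]
    exact cons k _ (fun i hi => hmax i (Multiset.mem_toFinset.2 (Multiset.mem_of_mem_erase hi)))
      (ih _ (Multiset.erase_lt.2 hk))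

/-- Forests are encoded by the multiset of the flags of their internal nodes.  If `c` is the code of
`F`, then `graft c i` is the code of the forest obtained from `F` by replacing leaf `i` by a node
with two leaves as children: the labels of all the leaves to the right of leaf `i` increase by one,
and there is a new node with flag `i`. -/
def graft (c : Multiset ℕ) (i : ℕ) : Multiset ℕ := i ::ₘ c.map (skip (i + 1))

theorem card_graft (c : Multiset ℕ) (i : ℕ) : (graft c i).card = c.card + 1 := by simp [graft]

theorem graft_ne_zero (c : Multiset ℕ) (i : ℕ) : graft c i ≠ 0 := Multiset.cons_ne_zero

theorem graft_injective (i : ℕ) : Function.Injective (graft · i) := fun _ _ h =>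
  Multiset.map_injective (skip_injective (i + 1)) ((Multiset.cons_inj_right i).1 h)

theorem graft_comm (c : Multiset ℕ) {i j : ℕ} (h : j < i) :
    graft (graft c i) j = graft (graft c j) (i + 1) := by
  have hi : skip (j + 1) i = i + 1 := by grind [skip]
  have hj : skip (i + 1 + 1) j = j := by grind [skip]
  simp only [graft, Multiset.map_cons, Multiset.map_map, hi, hj,
    skip_comp_skip (show j + 1 < i + 1 by omega)]
  exact Multiset.cons_swap _ _ _

theorem graft_eq_cons {c : Multiset ℕ} {i : ℕ} (h : ∀ j ∈ c, j ≤ i) : graft c i = i ::ₘ c := by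
  rw [graft, Multiset.map_congr rfl (g := id), Multiset.map_id]
  exact fun j hj => if_pos (Nat.lt_succ_of_le (h j hj))

theorem graft_cons_of_lt (c : Multiset ℕ) {i k : ℕ} (h : i < k) :
    graft (k ::ₘ c) i = (k + 1) ::ₘ graft c i := by
  rw [graft, graft, Multiset.map_cons, Multiset.cons_swap, skip, if_neg (by omega)]

theorem exists_eq_graft_iff {c : Multiset ℕ} {i : ℕ} :
    (∃ e, c = graft e i) ↔ i ∈ c ∧ i + 1 ∉ c := by
  constructor
  · rintro ⟨e, rfl⟩
    refine ⟨Multiset.mem_cons_self i _, fun h => ?_⟩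
    obtain h | ⟨j, _, hj⟩ : i + 1 = i ∨ ∃ j ∈ e, skip (i + 1) j = i + 1 := by simpa [graft] using h
    all_goals grind [skip]
  · rintro ⟨hi, hi'⟩
    refine ⟨(c.erase i).map fun j => if j ≤ i then j else j - 1, ?_⟩
    rw [graft, Multiset.map_map, Multiset.map_congr rfl (g := id), Multiset.map_id,
      Multiset.cons_erase hi]
    intro j hj
    have : j ≠ i + 1 := fun h => hi' (h ▸ Multiset.mem_of_mem_erase hj)
    grind [skip]

theorem exists_eq_graft_of_mem {c : Multiset ℕ} {k : ℕ} (h : k ∈ c) :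
    ∃ i e, k ≤ i ∧ c = graft e i := by
  obtain ⟨i, hi, hmax⟩ := c.toFinset.exists_max_image id ⟨k, Multiset.mem_toFinset.2 h⟩
  simp only [Multiset.mem_toFinset, id] at hi hmax
  obtain ⟨e, he⟩ := exists_eq_graft_iff.2 ⟨hi, fun h => absurd (hmax _ h) (by omega)⟩
  exact ⟨i, e, hmax k h, he⟩

theorem graft_induction {p : Multiset ℕ → Prop} (c : Multiset ℕ) (zero : p 0)
    (graft : ∀ c i, p c → p (graft c i)) : p c :=
  multiset_induction_on_max c zero fun k d h hd => graft_eq_cons h ▸ graft d k hd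

theorem eq_zero_or_exists_eq_graft (c : Multiset ℕ) : c = 0 ∨ ∃ i e, c = graft e i :=
  graft_induction (p := fun c => c = 0 ∨ ∃ i e, c = graft e i) c (Or.inl rfl) fun c i _ =>
    Or.inr ⟨i, c, rfl⟩

/-! ### Coefficient functionals -/

section Functionals

variable {R : Type*} [CommRing R] [IsDomain R]

/-- Apply the divided differences with the indices in `w`, leftmost first, then evaluate.  After a
divided difference with index `i` the parameter `τ i` is omitted, as in the recursion for the double
forest polynomials. -/
def wordCoeff : (ℕ → R) → List ℕ → (MvPolynomial ℕ R →ₗ[R] R)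
  | τ, [] => (aeval τ : MvPolynomial ℕ R →ₐ[R] R).toLinearMap
  | τ, i :: w => wordCoeff (τ ∘ skip i) w ∘ₗ divDiff (τ i) i

/-- The functional which extracts the coefficient of the forest polynomial with code `c`.
Trimming a node changes only the labels to its right, so that trimming the nodes of a forest in
decreasing order of their flags applies the divided differences indexed by the entries of `c`. -/
def forestCoeff (τ : ℕ → R) (c : Multiset ℕ) : MvPolynomial ℕ R →ₗ[R] R :=
  wordCoeff τ (c.sort (· ≥ ·))

theorem forestCoeff_zero (τ : ℕ → R) (f : MvPolynomial ℕ R) : forestCoeff τ 0 f = aeval τ f := by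
  simp [forestCoeff, wordCoeff]

theorem forestCoeff_cons_max (τ : ℕ → R) {c : Multiset ℕ} {i : ℕ} (h : ∀ j ∈ c, j ≤ i)
    (f : MvPolynomial ℕ R) :
    forestCoeff τ (i ::ₘ c) f = forestCoeff (τ ∘ skip i) c (divDiff (τ i) i f) := by
  rw [forestCoeff, Multiset.sort_cons i c (· ≥ ·) h]
  rfl

theorem forestCoeff_graft (τ : ℕ → R) (c : Multiset ℕ) (i : ℕ) (f : MvPolynomial ℕ R) :
    forestCoeff τ (graft c i) f = forestCoeff (τ ∘ skip i) c (divDiff (τ i) i f) := by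
  induction c using multiset_induction_on_max generalizing τ f with
  | zero => exact forestCoeff_cons_max τ (by simp) f
  | cons k d hd ih =>
    rcases le_or_gt k i with hki | hik
    · have hmax : ∀ j ∈ k ::ₘ d, j ≤ i := by
        simpa [hki] using fun j hj => (hd j hj).trans hki
      rw [graft_eq_cons hmax, forestCoeff_cons_max τ hmax]
    · have hmax : ∀ j ∈ graft d i, j ≤ k + 1 := by
        simp only [graft, Multiset.mem_cons, Multiset.mem_map]
        rintro j (rfl | ⟨j, hj, rfl⟩)
        · omega
        · grind [skip]
      calc forestCoeff τ (graft (k ::ₘ d) i) f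
          = forestCoeff (τ ∘ skip (k + 1) ∘ skip i) d
              (divDiff (τ i) i (divDiff (τ (k + 1)) (k + 1) f)) := by
            rw [graft_cons_of_lt d hik, forestCoeff_cons_max τ hmax, ih]
            simp [Function.comp_assoc, skip, show i < k + 1 by omega]
        _ = forestCoeff (τ ∘ skip i ∘ skip k) d
              (divDiff (τ (k + 1)) k (divDiff (τ i) i f)) := by
            rw [divDiff_comm _ _ hik, skip_comp_skip hik]
        _ = forestCoeff (τ ∘ skip i) (k ::ₘ d) (divDiff (τ i) i f) := by
            rw [forestCoeff_cons_max (τ ∘ skip i) hd]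
            simp [Function.comp_assoc, skip, show ¬ k < i by omega]

theorem forestCoeff_eq_zero_of_totalDegree_lt (τ : ℕ → R) {c : Multiset ℕ} {f : MvPolynomial ℕ R}
    (h : f.totalDegree < c.card) : forestCoeff τ c f = 0 := by
  induction c using graft_induction generalizing τ f with
  | zero => simp at h
  | graft c i ih =>
    rw [forestCoeff_graft]
    by_cases h0 : divDiff (τ i) i f = 0
    · rw [h0, map_zero]
    · have := totalDegree_divDiff_lt (τ i) i h0
      rw [card_graft] at h
      exact ih _ (by omega)

theorem forestCoeff_eq_zero_of_supported (τ : ℕ → R) {c : Multiset ℕ} {f : MvPolynomial ℕ R}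
    {n k : ℕ} (hf : f ∈ supported R (Set.Iio n)) (hk : k ∈ c) (hnk : n ≤ k) :
    forestCoeff τ c f = 0 := by
  obtain ⟨i, e, hki, rfl⟩ := exists_eq_graft_of_mem hk
  rw [forestCoeff_graft, divDiff_eq_zero_of_supported _ (hnk.trans hki) hf, map_zero]

theorem finite_forestCoeff_ne_zero (τ : ℕ → R) (f : MvPolynomial ℕ R) :
    {c | forestCoeff τ c f ≠ 0}.Finite := by
  obtain ⟨n, hn⟩ := exists_mem_supported_Iio f
  refine (Set.finite_Iic (f.totalDegree • Multiset.range n)).subset fun c hc => ?_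
  refine Multiset.le_iff_count.2 fun i => ?_
  by_cases hi : i ∈ c
  · have hin : i < n := not_le.1 fun h => hc (forestCoeff_eq_zero_of_supported τ hn hi h)
    have hcard : c.card ≤ f.totalDegree :=
      not_lt.1 fun h => hc (forestCoeff_eq_zero_of_totalDegree_lt τ h)
    rw [Multiset.count_nsmul, Multiset.count_eq_one_of_mem (Multiset.nodup_range n)
      (Multiset.mem_range.2 hin), mul_one]
    exact (Multiset.count_le_card i c).trans hcard
  · rw [Multiset.count_eq_zero_of_notMem hi]
    exact Nat.zero_le _

theorem eq_zero_of_forestCoeff_eq_zero (τ : ℕ → R) {f : MvPolynomial ℕ R}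
    (h : ∀ c, forestCoeff τ c f = 0) : f = 0 := by
  induction hd : f.totalDegree using Nat.strong_induction_on generalizing f τ with
  | _ d ih =>
    refine ext_divDiff τ (by rw [← forestCoeff_zero, h, map_zero]) fun i => ?_
    rw [map_zero]
    by_contra h0
    exact h0 (ih _ (hd ▸ totalDegree_divDiff_lt _ i h0) (τ ∘ skip i)
      (fun c => by rw [← forestCoeff_graft, h]) rfl)

theorem ext_forestCoeff (τ : ℕ → R) {f g : MvPolynomial ℕ R}
    (h : ∀ c, forestCoeff τ c f = forestCoeff τ c g) : f = g :=
  sub_eq_zero.1 (eq_zero_of_forestCoeff_eq_zero τ fun c => by rw [map_sub, h, sub_self])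

end Functionals

/-! ### Forest polynomials -/

section ForestPolynomials

variable {R S : Type*} [CommRing R] [IsDomain R] [CommRing S] [IsDomain S]

theorem exists_divDiff_eq {τ : ℕ → R} {g : ℕ → MvPolynomial ℕ R} {N : ℕ}
    (hN : ∀ i, N ≤ i → g i = 0)
    (hg : ∀ i j, j < i → divDiff (τ (i + 1)) i (g j) = divDiff (τ j) j (g (i + 1))) :
    ∃ f, aeval τ f = 0 ∧ ∀ i, divDiff (τ i) i f = g i := by
  induction N generalizing g with
  | zero => exact ⟨0, map_zero _, fun i => by rw [map_zero, hN i (Nat.zero_le i)]⟩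
  | succ N ih =>
    have hsupp : g N ∈ supported R (Set.Iio (N + 1)) :=
      mem_supported_of_divDiff (fun i => τ (i + 1)) fun i hi => by
        rw [hg i N hi, hN (i + 1) (by omega), map_zero]
    -- This is a primitive of the last nonzero `g i`, and subtracting its divided differences keeps
    -- the system compatible.
    set h := (X N - C (τ N)) * g N with hh
    have hsupp' : h ∈ supported R (Set.Iio (N + 1)) :=
      mul_mem (sub_mem (Algebra.subset_adjoin ⟨N, Nat.lt_succ_self N, rfl⟩)
        (Subalgebra.algebraMap_mem _ (τ N))) hsupp
    have hdiff : divDiff (τ N) N h = g N :=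
      divDiff_eq_of_mul_eq (by
        rw [insertAt_eq_self _ le_rfl hsupp', hh, map_mul, map_sub, insertAt_X_self, insertAt_C,
          sub_self, zero_mul, sub_zero])
    have hdiff' : ∀ i, N < i → divDiff (τ i) i h = 0 := fun i hi =>
      divDiff_eq_zero_of_supported _ hi hsupp'
    obtain ⟨f, hf0, hf⟩ := ih (g := fun i => g i - divDiff (τ i) i h)
      (fun i hi => by
        rcases hi.eq_or_lt with rfl | hi
        · rw [hdiff, sub_self]
        · rw [hdiff' i hi, hN i hi, sub_zero])
      (fun i j hij => by rw [map_sub, map_sub, hg i j hij, divDiff_comm _ _ hij])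
    refine ⟨f + h, ?_, fun i => ?_⟩
    · rw [map_add, hf0, zero_add, hh, map_mul, map_sub, aeval_X, aeval_C,
        Algebra.algebraMap_self_apply, sub_self, zero_mul]
    · rw [map_add, hf, sub_add_cancel]

theorem divDiff_comm_of_forestCoeff_eq {τ : ℕ → R} {φ : Multiset ℕ → R}
    {g : ℕ → MvPolynomial ℕ R} (hg : ∀ i e, forestCoeff (τ ∘ skip i) e (g i) = φ (graft e i))
    {i j : ℕ} (hij : j < i) : divDiff (τ (i + 1)) i (g j) = divDiff (τ j) j (g (i + 1)) := by
  refine ext_forestCoeff (τ ∘ skip j ∘ skip i) fun e => ?_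
  have hi := forestCoeff_graft (τ ∘ skip j) e i (g j)
  have hj := forestCoeff_graft (τ ∘ skip (i + 1)) e j (g (i + 1))
  have hi_skip : skip j i = i + 1 := if_neg (by omega)
  have hj_skip : skip (i + 1) j = j := if_pos (by omega)
  rw [hg, Function.comp_assoc, Function.comp_apply, hi_skip] at hi
  rw [hg, Function.comp_assoc, ← skip_comp_skip hij, Function.comp_apply, hj_skip,
    ← graft_comm e hij] at hj
  rw [← hi, ← hj]

theorem exists_forestCoeff_eq (τ : ℕ → R) (c : Multiset ℕ) :
    ∃ p, ∀ e, forestCoeff τ e p = if e = c then 1 else 0 := by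
  induction hd : c.card generalizing τ c with
  | zero =>
    obtain rfl := Multiset.card_eq_zero.1 hd
    refine ⟨1, fun e => ?_⟩
    rcases eq_zero_or_exists_eq_graft e with rfl | ⟨i, e, rfl⟩
    · simp [forestCoeff_zero]
    · rw [forestCoeff_graft, ← C_1, divDiff_C, map_zero, if_neg (graft_ne_zero e i)]
  | succ d ih =>
    have hdiff : ∀ i, ∃ p, ∀ e, forestCoeff (τ ∘ skip i) e p = if graft e i = c then 1 else 0 := by
      intro i
      by_cases h : ∃ e, c = graft e i
      · obtain ⟨c, rfl⟩ := h
        obtain ⟨p, hp⟩ := ih (τ ∘ skip i) c (by simpa [card_graft] using hd)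
        exact ⟨p, fun e => by simp only [hp, (graft_injective i).eq_iff]⟩
      · exact ⟨0, fun e => by rw [map_zero, if_neg fun he => h ⟨e, he.symm⟩]⟩
    choose g hg using hdiff
    have hvanish : ∀ i, c.sum + 1 ≤ i → g i = 0 := fun i hi =>
      eq_zero_of_forestCoeff_eq_zero (τ ∘ skip i) fun e => by
        rw [hg, if_neg]
        rintro rfl
        have := Multiset.le_sum_of_mem (Multiset.mem_cons_self i (e.map (skip (i + 1))))
        rw [← graft] at this
        omega
    obtain ⟨p, hp0, hp⟩ := exists_divDiff_eq hvanish fun _ _ =>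
      divDiff_comm_of_forestCoeff_eq (φ := fun b => if b = c then 1 else 0) hg
    refine ⟨p, fun e => ?_⟩
    rcases eq_zero_or_exists_eq_graft e with rfl | ⟨i, e, rfl⟩
    · rw [forestCoeff_zero, hp0, if_neg]
      rintro rfl
      simp at hd
    · rw [forestCoeff_graft, hp, hg]

/-- The forest polynomial with code `c` and parameters `τ`: the member with index `c` of the basis
dual to the functionals `forestCoeff τ`. -/
def forestPoly (τ : ℕ → R) (c : Multiset ℕ) : MvPolynomial ℕ R :=
  Classical.choose (exists_forestCoeff_eq τ c)

theorem forestCoeff_forestPoly (τ : ℕ → R) (c e : Multiset ℕ) :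
    forestCoeff τ e (forestPoly τ c) = if e = c then 1 else 0 :=
  Classical.choose_spec (exists_forestCoeff_eq τ c) e

theorem aeval_forestPoly (τ : ℕ → R) (c : Multiset ℕ) :
    aeval τ (forestPoly τ c) = if c = 0 then 1 else 0 := by
  rw [← forestCoeff_zero, forestCoeff_forestPoly]
  simp only [eq_comm]

theorem divDiff_forestPoly_graft (τ : ℕ → R) (c : Multiset ℕ) (i : ℕ) :
    divDiff (τ i) i (forestPoly τ (graft c i)) = forestPoly (τ ∘ skip i) c :=
  ext_forestCoeff (τ ∘ skip i) fun e => by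
    simp only [← forestCoeff_graft, forestCoeff_forestPoly, (graft_injective i).eq_iff]

theorem divDiff_forestPoly_eq_zero (τ : ℕ → R) {c : Multiset ℕ} {i : ℕ} (h : ¬ ∃ e, c = graft e i) :
    divDiff (τ i) i (forestPoly τ c) = 0 :=
  eq_zero_of_forestCoeff_eq_zero (τ ∘ skip i) fun e => by
    rw [← forestCoeff_graft, forestCoeff_forestPoly, if_neg fun he => h ⟨e, he.symm⟩]

theorem forestPoly_zero (τ : ℕ → R) : forestPoly τ 0 = 1 := by
  refine ext_divDiff τ (by simp [aeval_forestPoly]) fun i => ?_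
  rw [divDiff_forestPoly_eq_zero τ fun ⟨e, he⟩ => graft_ne_zero e i he.symm, ← C_1, divDiff_C]

theorem map_forestPoly (σ : R →+* S) (τ : ℕ → R) (c : Multiset ℕ) :
    map σ (forestPoly τ c) = forestPoly (σ ∘ τ) c := by
  induction hd : c.card using Nat.strong_induction_on generalizing τ c with
  | _ d ih =>
    refine ext_divDiff (σ ∘ τ) ?_ fun i => ?_
    · have hcomp : aeval (σ ∘ τ) (map σ (forestPoly τ c)) = σ (aeval τ (forestPoly τ c)) := by
        rw [map_aeval, aeval_def, eval₂_map]
        rfl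
      rw [hcomp, aeval_forestPoly, aeval_forestPoly]
      split_ifs <;> simp
    · rw [Function.comp_apply, ← map_divDiff]
      by_cases h : ∃ e, c = graft e i
      · obtain ⟨e, rfl⟩ := h
        rw [divDiff_forestPoly_graft, ih _ (by rw [← hd, card_graft]; omega) _ e rfl]
        exact (divDiff_forestPoly_graft (σ ∘ τ) e i).symm
      · rw [divDiff_forestPoly_eq_zero τ h, map_zero]
        exact (divDiff_forestPoly_eq_zero (σ ∘ τ) h).symm

theorem forestCoeff_linearCombination (τ : ℕ → R) (l : Multiset ℕ →₀ R) (c : Multiset ℕ) :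
    forestCoeff τ c (Finsupp.linearCombination R (forestPoly τ) l) = l c := by
  simp [Finsupp.linearCombination_apply, map_finsuppSum, forestCoeff_forestPoly]

/-- The forest polynomials as a basis of the polynomial ring. -/
def forestBasis (τ : ℕ → R) : Module.Basis (Multiset ℕ) R (MvPolynomial ℕ R) :=
  .ofRepr
    { toFun f := .ofSupportFinite (forestCoeff τ · f) (finite_forestCoeff_ne_zero τ f)
      map_add' f g := Finsupp.ext fun c => map_add (forestCoeff τ c) f g
      map_smul' a f := Finsupp.ext fun c => map_smul (forestCoeff τ c) a f
      invFun := Finsupp.linearCombination R (forestPoly τ)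
      left_inv _ := ext_forestCoeff τ fun c => forestCoeff_linearCombination τ _ c
      right_inv l := Finsupp.ext fun c => forestCoeff_linearCombination τ l c }

theorem forestBasis_repr_apply (τ : ℕ → R) (f : MvPolynomial ℕ R) (c : Multiset ℕ) :
    (forestBasis τ).repr f c = forestCoeff τ c f := rfl

theorem forestBasis_apply (τ : ℕ → R) (c : Multiset ℕ) : forestBasis τ c = forestPoly τ c := by
  change Finsupp.linearCombination R (forestPoly τ) (Finsupp.single c 1) = _
  rw [Finsupp.linearCombination_single, one_smul]

end ForestPolynomials

/-! ### Homogeneity -/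

section Homogeneity

theorem homogeneousComponent_add_one_mul {σ R : Type*} [CommRing R] {a : MvPolynomial σ R}
    (ha : a.IsHomogeneous 1) (g : MvPolynomial σ R) (k : ℕ) :
    homogeneousComponent (k + 1) (a * g) = a * homogeneousComponent k g := by
  have hcomp (j : ℕ) : homogeneousComponent (k + 1) (a * homogeneousComponent j g) =
      if j = k then a * homogeneousComponent k g else 0 := by
    have hmem : a * homogeneousComponent j g ∈ homogeneousSubmodule σ R (1 + j) :=
      ha.mul (homogeneousComponent_isHomogeneous j g)
    rw [homogeneousComponent_of_mem hmem]
    grind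
  conv_lhs => rw [← sum_homogeneousComponent g, Finset.mul_sum, map_sum]
  simp only [hcomp, Finset.sum_ite_eq', Finset.mem_range]
  split_ifs with hk
  · rfl
  · rw [homogeneousComponent_eq_zero _ _ (by omega), mul_zero]

theorem isHomogeneous_of_mul {σ R : Type*} [CommRing R] [IsDomain R] {a g : MvPolynomial σ R}
    (ha : a.IsHomogeneous 1) (ha0 : a ≠ 0) {d : ℕ} (h : (a * g).IsHomogeneous (d + 1)) :
    g.IsHomogeneous d := by
  have hg : homogeneousComponent d g = g := mul_left_cancel₀ ha0 <| by
    rw [← homogeneousComponent_add_one_mul ha, homogeneousComponent_of_mem h, if_pos rfl]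
  exact hg ▸ homogeneousComponent_isHomogeneous d g

/-- The polynomials that are homogeneous of degree `d` in the variables `x` and `t` together. -/
def homogeneousTX (d : ℕ) : Submodule ℤ PolyTX :=
  (homogeneousSubmodule (ℕ ⊕ ℕ) ℤ d).comap (sumAlgEquiv ℤ ℕ ℕ).symm.toLinearMap

variable {d e : ℕ} {f g : PolyTX}

theorem mem_homogeneousTX :
    f ∈ homogeneousTX d ↔ ((sumAlgEquiv ℤ ℕ ℕ).symm f).IsHomogeneous d := Iff.rfl

theorem X_mem_homogeneousTX (i : ℕ) : (X i : PolyTX) ∈ homogeneousTX 1 := by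
  rw [mem_homogeneousTX, sumAlgEquiv_symm_X]
  exact isHomogeneous_X _ _

theorem C_X_mem_homogeneousTX (i : ℕ) : (C (X i) : PolyTX) ∈ homogeneousTX 1 := by
  rw [mem_homogeneousTX, sumAlgEquiv_symm_C_X]
  exact isHomogeneous_X _ _

theorem one_mem_homogeneousTX : (1 : PolyTX) ∈ homogeneousTX 0 := by
  rw [mem_homogeneousTX, map_one]
  exact isHomogeneous_one _ _

theorem mul_mem_homogeneousTX (hf : f ∈ homogeneousTX d) (hg : g ∈ homogeneousTX e) :
    f * g ∈ homogeneousTX (d + e) := by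
  rw [mem_homogeneousTX, map_mul]
  exact IsHomogeneous.mul hf hg

theorem algHom_mem_homogeneousTX {φ : PolyTX →ₐ[ℤ] PolyTX}
    (hX : ∀ i, φ (X i) ∈ homogeneousTX 1) (hC : ∀ i, φ (C (X i)) ∈ homogeneousTX 1)
    (hf : f ∈ homogeneousTX d) : φ f ∈ homogeneousTX d := by
  set ε := sumAlgEquiv ℤ ℕ ℕ
  obtain ⟨p, rfl⟩ := ε.surjective f
  rw [mem_homogeneousTX, AlgEquiv.symm_apply_apply] at hf
  have hvar (v : ℕ ⊕ ℕ) : (ε.symm (φ (ε (X v)))).IsHomogeneous 1 := by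
    rcases v with i | i
    · rw [sumAlgEquiv_X_inl]
      exact hX i
    · rw [sumAlgEquiv_X_inr]
      exact hC i
  have haeval : aeval (fun v => ε.symm (φ (ε (X v)))) = (ε.symm : PolyTX →ₐ[ℤ] _).comp (φ.comp ε) :=
    algHom_ext fun v => by simp
  have := hf.aeval _ hvar
  rwa [one_mul, haeval] at this

theorem insertAt_mem_homogeneousTX {y : CoeffT} (hy : C y ∈ homogeneousTX 1) (i : ℕ)
    (hf : f ∈ homogeneousTX d) : insertAt y i f ∈ homogeneousTX d := by
  refine algHom_mem_homogeneousTX (φ := (insertAt y i).restrictScalars ℤ) (fun j => ?_)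
    (fun j => ?_) hf
  · change insertAt y i (X j) ∈ homogeneousTX 1
    rcases lt_trichotomy j i with h | rfl | h
    · rw [insertAt_X_of_lt y h]
      exact X_mem_homogeneousTX j
    · rwa [insertAt_X_self]
    · rw [insertAt_X_of_gt y h]
      exact X_mem_homogeneousTX (j - 1)
  · change insertAt y i (C (X j)) ∈ homogeneousTX 1
    rw [insertAt_C]
    exact C_X_mem_homogeneousTX j

theorem divDiff_mem_homogeneousTX {y : CoeffT} (hy : C y ∈ homogeneousTX 1) (i : ℕ)
    (hf : f ∈ homogeneousTX (d + 1)) : divDiff y i f ∈ homogeneousTX d := by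
  refine mem_homogeneousTX.2 (isHomogeneous_of_mul
    (mem_homogeneousTX.1 (sub_mem (X_mem_homogeneousTX i) hy))
    ((map_ne_zero_iff _ (sumAlgEquiv ℤ ℕ ℕ).symm.injective).2 (X_sub_C_ne_zero y i)) ?_)
  rw [← map_mul, X_sub_C_mul_divDiff, ← mem_homogeneousTX]
  exact sub_mem (insertAt_mem_homogeneousTX hy _ hf) (insertAt_mem_homogeneousTX hy _ hf)

theorem mem_homogeneousTX_of_divDiff {τ : ℕ → CoeffT} (hτ : ∀ i, C (τ i) ∈ homogeneousTX 1)
    (h0 : aeval τ f = 0) (hf : ∀ i, divDiff (τ i) i f ∈ homogeneousTX d) :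
    f ∈ homogeneousTX (d + 1) := by
  obtain ⟨n, hn⟩ := exists_mem_supported_Iio f
  induction n generalizing f with
  | zero =>
    have hconst := eq_C_aeval_of_divDiff_eq_zero τ fun i =>
      divDiff_eq_zero_of_supported (τ i) i.zero_le hn
    rw [hconst, h0, C_0]
    exact zero_mem _
  | succ n ih =>
    set h := (X n - C (τ n)) * divDiff (τ n) n f with hh
    have h_mem : h ∈ homogeneousTX (d + 1) := by
      rw [add_comm]
      exact mul_mem_homogeneousTX (sub_mem (X_mem_homogeneousTX n) (hτ n)) (hf n)
    have h_aeval : aeval τ h = 0 := by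
      rw [hh, map_mul, map_sub, aeval_X, aeval_C, Algebra.algebraMap_self_apply, sub_self, zero_mul]
    have h_sub : f - h = insertAt (τ n) n f := by
      rw [hh, X_sub_C_mul_divDiff, insertAt_eq_self _ le_rfl hn, sub_sub_cancel]
    refine (Submodule.sub_mem_iff_left _ h_mem).1 (ih ?_ (fun i => ?_) ?_)
    · rw [map_sub, h0, h_aeval, sub_zero]
    · rw [map_sub]
      exact sub_mem (hf i) (divDiff_mem_homogeneousTX (hτ i) i h_mem)
    · rw [h_sub]
      exact insertAt_mem_supported _ _ hn

theorem forestPoly_mem_homogeneousTX {τ : ℕ → CoeffT} (hτ : ∀ i, C (τ i) ∈ homogeneousTX 1)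
    (c : Multiset ℕ) : forestPoly τ c ∈ homogeneousTX c.card := by
  induction hd : c.card generalizing τ c with
  | zero =>
    rw [Multiset.card_eq_zero.1 hd, forestPoly_zero]
    exact one_mem_homogeneousTX
  | succ d ih =>
    refine mem_homogeneousTX_of_divDiff hτ ?_ fun i => ?_
    · rw [aeval_forestPoly, if_neg (by rintro rfl; simp at hd)]
    · by_cases h : ∃ e, c = graft e i
      · obtain ⟨e, rfl⟩ := h
        rw [divDiff_forestPoly_graft]
        exact ih (fun j => hτ _) e (by simpa [card_graft] using hd)
      · rw [divDiff_forestPoly_eq_zero τ h]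
        exact zero_mem _

end Homogeneity

/-! ### Fundamental quasisymmetric polynomials -/

section Words

open Classical in
/-- The weakly increasing words of length `m` in the alphabet `{0, …, n - 1}` that increase strictly
between the positions `q - 1` and `q` for all `q ∈ A`. -/
def strictWords (n m : ℕ) (A : Set ℕ) : Finset (Fin m → Fin n) :=
  Finset.univ.filter fun f =>
    Monotone f ∧ ∀ p q : Fin m, (p : ℕ) + 1 = q → (q : ℕ) ∈ A → f p < f q

/-- The generating polynomial of `strictWords n m A`. -/
def wordSum (n m : ℕ) (A : Set ℕ) : MvPolynomial ℕ ℤ :=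
  ∑ f ∈ strictWords n m A, ∏ j, X (f j : ℕ)

theorem fundamental_eq_wordSum {n : ℕ} (c : Fin n → ℕ) :
    fundamental c = wordSum n (∑ k, c k) (partialSums c) := rfl

variable {n m : ℕ} {A : Set ℕ}

theorem mem_strictWords {f : Fin m → Fin n} : f ∈ strictWords n m A ↔
    Monotone f ∧ ∀ p q : Fin m, (p : ℕ) + 1 = q → (q : ℕ) ∈ A → f p < f q := by
  simp [strictWords]

theorem wordSum_zero_right (n : ℕ) (A : Set ℕ) : wordSum n 0 A = 1 := by
  have : strictWords n 0 A = Finset.univ :=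
    Finset.eq_univ_of_forall fun f => mem_strictWords.2 ⟨fun a => a.elim0, fun p => p.elim0⟩
  simp [wordSum, this]

theorem aeval_wordSum_add_one (n m : ℕ) (A : Set ℕ) :
    aeval (0 : ℕ → ℤ) (wordSum n (m + 1) A) = 0 := by
  simp [wordSum]

theorem wordSum_mem_supported (n m : ℕ) (A : Set ℕ) : wordSum n m A ∈ supported ℤ (Set.Iio n) :=
  sum_mem fun f _ => prod_mem fun j _ => Algebra.subset_adjoin ⟨f j, (f j).isLt, rfl⟩

theorem succAbove_comp_mem_strictWords (i : Fin (n + 1)) {g : Fin m → Fin n} :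
    i.succAbove ∘ g ∈ strictWords (n + 1) m A ↔ g ∈ strictWords n m A := by
  simp only [mem_strictWords, Monotone, Function.comp_apply, Fin.succAbove_le_succAbove_iff,
    Fin.succAbove_lt_succAbove_iff]

open Classical in
theorem filter_strictWords_forall_ne (i : Fin (n + 1)) :
    (strictWords (n + 1) m A).filter (∀ j, · j ≠ i) =
      (strictWords n m A).image (i.succAbove ∘ ·) := by
  ext f
  simp only [Finset.mem_filter, Finset.mem_image]
  constructor
  · rintro ⟨hf, hi⟩
    choose g hg using fun j => Fin.exists_succAbove_eq (hi j)
    obtain rfl : i.succAbove ∘ g = f := funext hg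
    exact ⟨g, (succAbove_comp_mem_strictWords i).1 hf, rfl⟩
  · rintro ⟨g, hg, rfl⟩
    exact ⟨(succAbove_comp_mem_strictWords i).2 hg, fun j => Fin.succAbove_ne i (g j)⟩

open Classical in
theorem sum_strictWords_forall_ne {M : Type*} [AddCommMonoid M] (i : Fin (n + 1))
    (F : (Fin m → Fin (n + 1)) → M) :
    ∑ f ∈ strictWords (n + 1) m A with ∀ j, f j ≠ i, F f =
      ∑ g ∈ strictWords n m A, F (i.succAbove ∘ g) := by
  rw [filter_strictWords_forall_ne, Finset.sum_image]
  exact fun f _ g _ h => i.succAbove_right_injective.comp_left h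

theorem insertAt_X_succAbove (i : Fin (n + 1)) (k : Fin n) :
    insertAt (0 : ℤ) i (X (i.succAbove k : ℕ)) = X (k : ℕ) := by
  rcases lt_or_ge k.castSucc i with h | h
  · rw [Fin.succAbove_of_castSucc_lt _ _ h, Fin.val_castSucc]
    exact insertAt_X_of_lt _ h
  · rw [Fin.succAbove_of_le_castSucc _ _ h, Fin.val_succ]
    exact insertAt_X_of_gt _ (Nat.lt_succ_of_le h)

theorem insertAt_wordSum {i : ℕ} (hi : i ≤ n) :
    insertAt 0 i (wordSum (n + 1) m A) = wordSum n m A := by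
  classical
  lift i to Fin (n + 1) using Nat.lt_succ_of_le hi
  calc insertAt 0 i (wordSum (n + 1) m A)
    _ = ∑ f ∈ strictWords (n + 1) m A, ∏ j, insertAt 0 i (X (f j : ℕ)) := by
      simp only [wordSum, map_sum, map_prod]
    _ = ∑ f ∈ strictWords (n + 1) m A with ∀ j, f j ≠ i, ∏ j, insertAt 0 i (X (f j : ℕ)) := by
      refine (Finset.sum_filter_of_ne fun f _ hf j hj => hf ?_).symm
      exact Finset.prod_eq_zero (Finset.mem_univ j) (by rw [hj, insertAt_X_self, C_0])
    _ = wordSum n m A := by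
      simp only [sum_strictWords_forall_ne, Function.comp_apply, insertAt_X_succAbove, wordSum]

theorem divDiff_wordSum_eq_zero {i : ℕ} (hi : i + 1 ≠ n) : divDiff 0 i (wordSum n m A) = 0 := by
  rcases hi.lt_or_gt with h | h
  · obtain ⟨n, rfl⟩ := Nat.exists_eq_add_of_lt (Nat.lt_of_succ_lt h)
    rw [divDiff_eq_zero_iff, insertAt_wordSum (by omega), insertAt_wordSum (by omega)]
  · exact divDiff_eq_zero_of_supported 0 (Nat.lt_succ_iff.1 h) (wordSum_mem_supported n m A)

theorem snoc_last_mem_strictWords {g : Fin m → Fin (n + 1)} :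
    (Fin.snoc g (Fin.last n) : Fin (m + 1) → Fin (n + 1)) ∈ strictWords (n + 1) (m + 1) A ↔
      g ∈ strictWords (n + 1) m A ∧ (m ∈ A → ∀ j, g j ≠ Fin.last n) := by
  have hmax (hg : Monotone g) : (∀ p : Fin m, (p : ℕ) + 1 = m → g p < Fin.last n) ↔
      ∀ j, g j ≠ Fin.last n := by
    refine ⟨fun h j => ?_, fun h p _ => (h p).lt_top⟩
    have hm := j.pos
    have hj : j ≤ ⟨m - 1, by omega⟩ := Fin.le_def.2 (by simp only; omega)
    exact ((hg hj).trans_lt (h _ (by simp only; omega))).ne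
  simp only [mem_strictWords, Monotone, Fin.forall_fin_succ', Fin.snoc_castSucc, Fin.snoc_last,
    Fin.castSucc_le_castSucc_iff, Fin.val_castSucc, Fin.val_last] at hmax ⊢
  grind [Fin.le_last, Fin.castSucc_lt_last]

open Classical in
theorem sum_strictWords_last_eq {M : Type*} [AddCommMonoid M]
    (F : (Fin (m + 1) → Fin (n + 1)) → M) :
    ∑ f ∈ strictWords (n + 1) (m + 1) A with f (Fin.last m) = Fin.last n, F f =
      ∑ g ∈ strictWords (n + 1) m A with m ∈ A → ∀ j, g j ≠ Fin.last n,
        F (Fin.snoc g (Fin.last n)) := by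
  symm
  refine Finset.sum_bij' (fun g _ => Fin.snoc g (Fin.last n)) (fun f _ => Fin.init f)
    (fun g hg => ?_) (fun f hf => ?_) (fun g _ => Fin.init_snoc _ _) (fun f hf => ?_)
    (fun g _ => rfl)
  · rw [Finset.mem_filter] at hg ⊢
    exact ⟨snoc_last_mem_strictWords.2 hg, Fin.snoc_last _ _⟩
  · rw [Finset.mem_filter] at hf ⊢
    rw [← snoc_last_mem_strictWords, ← hf.2, Fin.snoc_init_self]
    exact hf.1
  · rw [← (Finset.mem_filter.1 hf).2, Fin.snoc_init_self]

theorem wordSum_add_one (n m : ℕ) (A : Set ℕ) [Decidable (m ∈ A)] :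
    wordSum (n + 1) (m + 1) A = X n * (if m ∈ A then wordSum n m A else wordSum (n + 1) m A) +
      wordSum n (m + 1) A := by
  classical
  have hne : (strictWords (n + 1) (m + 1) A).filter (fun f => f (Fin.last m) ≠ Fin.last n) =
      (strictWords (n + 1) (m + 1) A).filter (∀ j, · j ≠ Fin.last n) := by
    refine Finset.filter_congr fun f hf => ⟨fun h j => ?_, fun h => h _⟩
    exact (((mem_strictWords.1 hf).1 j.le_last).trans_lt h.lt_top).ne
  have hsnoc (g : Fin m → Fin (n + 1)) :
      ∏ j, X ((Fin.snoc g (Fin.last n) : Fin (m + 1) → Fin (n + 1)) j : ℕ) =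
        (X n * ∏ j, X (g j : ℕ) : MvPolynomial ℕ ℤ) := by
    simp only [Fin.prod_univ_castSucc, Fin.snoc_castSucc, Fin.snoc_last, Fin.val_last, mul_comm]
  rw [wordSum, ← Finset.sum_filter_add_sum_filter_not _ fun f => f (Fin.last m) = Fin.last n, hne,
    sum_strictWords_last_eq, sum_strictWords_forall_ne]
  simp only [hsnoc, ← Finset.mul_sum, Function.comp_apply, Fin.succAbove_last_apply,
    Fin.val_castSucc]
  congr 2
  split_ifs with hm
  · simp only [hm, true_imp_iff, sum_strictWords_forall_ne, Function.comp_apply,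
      Fin.succAbove_last_apply, Fin.val_castSucc, wordSum]
  · simp only [hm, false_imp_iff, Finset.filter_true, wordSum]

theorem divDiff_wordSum (n m : ℕ) (A : Set ℕ) [Decidable (m ∈ A)] :
    divDiff 0 n (wordSum (n + 1) (m + 1) A) =
      if m ∈ A then wordSum n m A else wordSum (n + 1) m A :=
  divDiff_eq_of_mul_eq <| by
    rw [insertAt_wordSum le_rfl, insertAt_eq_self 0 le_rfl (wordSum_mem_supported _ _ A),
      wordSum_add_one, C_0, sub_zero, add_sub_cancel_right]

end Words

/-! ### Zigzag codes -/

section Zigzag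

/-- The codes of the zigzag forests: the only position where an entry of the code is nonzero and the
next one is zero is the `n`-th one. -/
def IsZigzag (n : ℕ) (c : Multiset ℕ) : Prop := ∀ i ∈ c, i + 1 ∉ c → i + 1 = n

/-- The partial sums `c₀ + ⋯ + c_{k-1}` of a code, including `0` and the sum of all entries. -/
def cuts (c : Multiset ℕ) : Set ℕ := Set.range fun k => c.countP (· < k)

variable {n : ℕ} {c : Multiset ℕ}

theorem isZigzag_iff : IsZigzag n c ↔ ∀ i, (∃ e, c = graft e i) → i + 1 = n := by
  simp only [IsZigzag, exists_eq_graft_iff, and_imp]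

theorem IsZigzag.lt_of_mem (h : IsZigzag n c) {i : ℕ} (hi : i ∈ c) : i < n := by
  obtain ⟨j, e, hij, hc⟩ := exists_eq_graft_of_mem hi
  have := isZigzag_iff.1 h j ⟨e, hc⟩
  omega

theorem IsZigzag.mem_of_le (h : IsZigzag n c) {i j : ℕ} (hi : i ∈ c) (hij : i ≤ j) (hj : j < n) :
    j ∈ c := by
  induction j, hij using Nat.le_induction with
  | base => exact hi
  | succ j _ ih => exact not_not.1 fun hc => hj.ne (h j (ih (by omega)) hc)

theorem mem_cuts_cons_of_lt {k : ℕ} {u : Multiset ℕ} (hmax : ∀ j ∈ u, j ≤ k) {s : ℕ}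
    (hs : s < u.card) : s ∈ cuts (k ::ₘ u) ↔ s ∈ cuts u := by
  refine exists_congr fun l => ?_
  rcases le_or_gt l k with hl | hl
  · simp [hl.not_gt]
  · have : u.countP (· < l) = u.card :=
      Multiset.countP_eq_card.2 fun j hj => (hmax j hj).trans_lt hl
    simp only [Multiset.countP_cons, this, if_pos hl]
    omega

theorem card_mem_cuts_cons {k : ℕ} {u : Multiset ℕ} (hmax : ∀ j ∈ u, j ≤ k) :
    u.card ∈ cuts (k ::ₘ u) ↔ k ∉ u := by
  constructor
  · rintro ⟨l, hl⟩ hk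
    simp only [Multiset.countP_cons] at hl
    split_ifs at hl with hkl
    · rw [Multiset.countP_eq_card.2 fun j hj => (hmax j hj).trans_lt hkl] at hl
      omega
    · exact hkl (Multiset.countP_eq_card.1 hl k hk)
  · refine fun hk => ⟨k, ?_⟩
    simp only [Multiset.countP_cons, lt_irrefl, if_false, add_zero, Multiset.countP_eq_card]
    exact fun j hj => (hmax j hj).lt_of_ne fun h => hk (h ▸ hj)

theorem IsZigzag.of_cons {k : ℕ} {u : Multiset ℕ} (hmax : ∀ j ∈ u, j ≤ k)
    (h : IsZigzag n (k ::ₘ u)) : IsZigzag (if k ∈ u then k + 1 else k) u := by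
  obtain rfl : k + 1 = n := isZigzag_iff.1 h k ⟨u, (graft_eq_cons hmax).symm⟩
  intro i hi hi'
  have := hmax i hi
  have := h i (Multiset.mem_cons_of_mem hi)
  grind

theorem wordSum_eq_forestPoly {A : Set ℕ} (hc : IsZigzag n c)
    (hA : ∀ s, 0 < s → s < c.card → (s ∈ A ↔ s ∈ cuts c)) :
    wordSum n c.card A = forestPoly 0 c := by
  classical
  induction c using multiset_induction_on_max generalizing n with
  | zero => rw [Multiset.card_zero, wordSum_zero_right, forestPoly_zero]
  | cons k u hmax ih =>
    have hu := hc.of_cons hmax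
    have hAu (s : ℕ) (hs : 0 < s) (hsu : s < u.card) : s ∈ A ↔ s ∈ cuts u := by
      rw [hA s hs (by rw [Multiset.card_cons]; omega), mem_cuts_cons_of_lt hmax hsu]
    obtain rfl : k + 1 = n := isZigzag_iff.1 hc k ⟨u, (graft_eq_cons hmax).symm⟩
    rw [Multiset.card_cons] at hA ⊢
    refine ext_divDiff 0 ?_ fun i => ?_
    · rw [aeval_wordSum_add_one, aeval_forestPoly, if_neg Multiset.cons_ne_zero]
    rcases ne_or_eq i k with hi | rfl
    · exact (divDiff_wordSum_eq_zero (by omega)).trans (divDiff_forestPoly_eq_zero 0 fun h =>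
        hi (Nat.succ_injective (isZigzag_iff.1 hc i h))).symm
    rw [← graft_eq_cons hmax, divDiff_forestPoly_graft, Pi.zero_apply, divDiff_wordSum,
      Pi.zero_comp]
    rcases u.empty_or_exists_mem with rfl | ⟨j, hj⟩
    · simp only [Multiset.card_zero, wordSum_zero_right, ite_self, forestPoly_zero]
    have hcard : u.card ∈ A ↔ i ∉ u := by
      rw [hA _ (Multiset.card_pos_iff_exists_mem.2 ⟨j, hj⟩) (Nat.lt_succ_self _),
        card_mem_cuts_cons hmax]
    by_cases hiu : i ∈ u
    · rw [if_pos hiu] at hu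
      rw [if_neg (hcard.not_left.2 hiu), ih hu hAu]
    · rw [if_neg hiu] at hu
      rw [if_pos (hcard.2 hiu), ih hu hAu]

/-- The code of the forest `F_c` of a finite sequence `c`, as a multiset. -/
def padCode {n : ℕ} (c : Fin n → ℕ) : Multiset ℕ := ∑ k, Multiset.replicate (c k) (k : ℕ)

variable {c : Fin n → ℕ}

theorem count_padCode (c : Fin n → ℕ) (i : ℕ) : (padCode c).count i = appendZeros c i := by
  rw [padCode, Multiset.count_sum', appendZeros]
  split_ifs with h
  · rw [Finset.sum_eq_single ⟨i, h⟩ (fun k _ hk => ?_) (by simp)]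
    · simp
    · rw [Multiset.count_replicate, if_neg fun hki => hk (Fin.ext hki)]
  · refine Finset.sum_eq_zero fun k _ => ?_
    rw [Multiset.count_replicate, if_neg (by omega)]

theorem mem_padCode {k : Fin n} : (k : ℕ) ∈ padCode c ↔ 0 < c k := by
  rw [← Multiset.count_pos, count_padCode, appendZeros, dif_pos k.isLt]

theorem lt_of_mem_padCode {i : ℕ} (h : i ∈ padCode c) : i < n := by
  by_contra hi
  rw [← Multiset.count_pos, count_padCode, appendZeros, dif_neg hi] at h
  exact h.false

theorem card_padCode (c : Fin n → ℕ) : (padCode c).card = ∑ k, c k := by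
  simp [padCode]

theorem padCode_injective : Function.Injective (padCode (n := n)) := by
  intro c c' h
  funext k
  simpa [count_padCode, appendZeros] using congrArg (Multiset.count (k : ℕ)) h

theorem isZigzag_padCode : IsZigzag n (padCode c) ↔ c ∈ padded n := by
  constructor
  · intro h
    refine ⟨sInf (insert n {i | i ∈ padCode c}), Nat.sInf_le (Set.mem_insert _ _), fun k => ?_⟩
    rw [← mem_padCode]
    refine ⟨fun hk => Nat.sInf_le (Set.mem_insert_of_mem _ hk), fun hk => ?_⟩
    rcases Nat.sInf_mem (Set.insert_nonempty n {i | i ∈ padCode c}) with hm | hm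
    · exact absurd (hm.ge.trans hk) k.isLt.not_ge
    · exact h.mem_of_le hm hk k.isLt
  · rintro ⟨m, -, hm⟩ i hi hi'
    have hin := lt_of_mem_padCode hi
    by_contra hne
    have hmi := (hm ⟨i, hin⟩).1 (mem_padCode.1 hi)
    exact hi' ((mem_padCode (k := ⟨i + 1, by omega⟩)).2 ((hm _).2 (Nat.le_succ_of_le hmi)))

theorem exists_padCode_eq {c : Multiset ℕ} (h : IsZigzag n c) :
    ∃ c' ∈ padded n, padCode c' = c := by
  have hc : padCode (fun k : Fin n => c.count (k : ℕ)) = c := by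
    ext i
    rw [count_padCode, appendZeros]
    split_ifs with hi
    · rfl
    · exact (Multiset.count_eq_zero.2 fun hic => hi (h.lt_of_mem hic)).symm
  exact ⟨_, isZigzag_padCode.1 (hc.symm ▸ h), hc⟩

theorem countP_padCode (c : Fin n → ℕ) (k : Fin n) :
    (padCode c).countP (· < (k : ℕ) + 1) = ∑ j ∈ Finset.Iic k, c j := by
  have hk (j : Fin n) :
      (Multiset.replicate (c j) (j : ℕ)).countP (· < (k : ℕ) + 1) = if j ≤ k then c j else 0 := by
    split_ifs with h
    · rw [Multiset.countP_eq_card.2 fun i hi => ?_, Multiset.card_replicate]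
      rw [Multiset.eq_of_mem_replicate hi]
      exact Nat.lt_succ_of_le h
    · refine Multiset.countP_eq_zero.2 fun i hi hik => h ?_
      rw [Multiset.eq_of_mem_replicate hi] at hik
      exact Nat.le_of_lt_succ hik
  rw [padCode, ← Multiset.coe_countPAddMonoidHom, map_sum, ← Finset.filter_ge_eq_Iic,
    Finset.sum_filter]
  exact Finset.sum_congr rfl fun j _ => hk j

theorem mem_partialSums_iff (hc : c ∈ padded n) {s : ℕ} (hs : 0 < s) (hs' : s < ∑ k, c k) :
    s ∈ partialSums c ↔ s ∈ cuts (padCode c) := by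
  rw [← isZigzag_padCode] at hc
  constructor
  · rintro ⟨k, -, -, rfl⟩
    exact ⟨k + 1, countP_padCode c k⟩
  rintro ⟨l, rfl⟩
  rw [← card_padCode] at hs'
  obtain ⟨i, hi, hil⟩ := Multiset.countP_pos.1 hs
  have hln : l < n := by
    by_contra hl
    exact hs'.ne (Multiset.countP_eq_card.2 fun j hj => (hc.lt_of_mem hj).trans_le (not_lt.1 hl))
  obtain ⟨k, rfl⟩ : ∃ k, l = k + 1 := ⟨l - 1, by omega⟩
  exact ⟨⟨k, by omega⟩, mem_padCode.1 (hc.mem_of_le hi (Nat.lt_succ_iff.1 hil) (by omega)), hln,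
    countP_padCode c ⟨k, by omega⟩⟩

theorem fundamental_eq_forestPoly (hc : c ∈ padded n) :
    fundamental c = forestPoly 0 (padCode c) := by
  rw [fundamental_eq_wordSum, ← card_padCode,
    wordSum_eq_forestPoly (isZigzag_padCode.2 hc) fun s hs hs' =>
      mem_partialSums_iff hc hs (hs'.trans_eq (card_padCode c))]

end Zigzag

/-! ### Growing and trimming forests -/

section Trees

variable {o i : ℕ} {T : BinaryTree Unit}

/-- Turn leaf `i` into a terminal node, if it is a leaf of the tree, in a tree whose leaves are
labelled `o, o + 1, …`; the inverse operation of `treeTrim`. -/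
def treeGrow (i : ℕ) : ℕ → BinaryTree Unit → BinaryTree Unit
  | o, .nil => if o = i then .node () .nil .nil else .nil
  | o, .node _ l r => .node () (treeGrow i o l) (treeGrow i (o + l.numLeaves) r)

theorem skip_add_numLeaves_treeGrow (i o : ℕ) (T : BinaryTree Unit) :
    skip (i + 1) o + (treeGrow i o T).numLeaves = skip (i + 1) (o + T.numLeaves) := by
  induction T generalizing o with
  | nil => grind [treeGrow, BinaryTree.numLeaves, skip]
  | node _ l r ihl ihr =>
    rw [treeGrow, BinaryTree.numLeaves, BinaryTree.numLeaves, ← add_assoc, ← add_assoc, ihl, ihr]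

theorem treeFlags_treeGrow (i o : ℕ) (T : BinaryTree Unit) :
    treeFlags (skip (i + 1) o) (treeGrow i o T) = (treeFlags o T).map (skip (i + 1)) +
      if o ≤ i ∧ i < o + T.numLeaves then {i} else 0 := by
  induction T generalizing o with
  | nil =>
    rcases eq_or_ne o i with rfl | h
    · simp [treeGrow, treeFlags, skip, BinaryTree.numLeaves]
    · rw [treeGrow, if_neg h, BinaryTree.numLeaves, if_neg (by omega)]
      rfl
  | node _ l r ihl ihr =>
    have hsplit : (if o ≤ i ∧ i < o + (l.numLeaves + r.numLeaves) then {i} else 0) =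
        (if o ≤ i ∧ i < o + l.numLeaves then {i} else (0 : Multiset ℕ)) +
        if o + l.numLeaves ≤ i ∧ i < o + l.numLeaves + r.numLeaves then {i} else 0 := by
      split_ifs <;> first | omega | rfl
    rw [treeGrow, treeFlags, treeFlags, skip_add_numLeaves_treeGrow, ihl, ihr,
      BinaryTree.numLeaves, hsplit, Multiset.map_cons, Multiset.map_add, Multiset.cons_add,
      add_add_add_comm]

theorem mem_treeFlags (h : i ∈ treeFlags o T) : o ≤ i ∧ i + 1 < o + T.numLeaves := by
  induction T generalizing o with
  | nil => exact absurd h (Multiset.notMem_zero i)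
  | node _ l r ihl ihr =>
    have hl := l.numLeaves_pos
    have hr := r.numLeaves_pos
    rw [BinaryTree.numLeaves]
    rw [treeFlags, Multiset.mem_cons, Multiset.mem_add] at h
    rcases h with rfl | h | h
    · omega
    · have := ihl h
      omega
    · have := ihr h
      omega

theorem self_mem_treeFlags (h : T ≠ .nil) : o ∈ treeFlags o T := by
  cases T with
  | nil => exact absurd rfl h
  | node _ l r => exact Multiset.mem_cons_self _ _

theorem mem_treeFlags_of_mem_treeTerminalFlags (h : i ∈ treeTerminalFlags o T) :
    i ∈ treeFlags o T := by
  induction T generalizing o with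
  | nil => exact absurd h (Set.notMem_empty i)
  | node _ l r ihl ihr =>
    rw [treeTerminalFlags] at h
    rw [treeFlags, Multiset.mem_cons, Multiset.mem_add]
    split_ifs at h with hlr
    · exact Or.inl h
    · exact Or.inr (h.imp ihl ihr)

theorem mem_treeTerminalFlags_of_succ_notMem (h : i ∈ treeFlags o T)
    (h' : i + 1 ∉ treeFlags o T) : i ∈ treeTerminalFlags o T := by
  induction T generalizing o with
  | nil => exact absurd h (Multiset.notMem_zero i)
  | node _ l r ihl ihr =>
    simp only [treeFlags, Multiset.mem_cons, Multiset.mem_add, not_or] at h h'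
    rw [treeTerminalFlags]
    split_ifs with hlr
    · obtain ⟨rfl, rfl⟩ := hlr
      simpa [treeFlags] using h
    rcases h with rfl | h | h
    · by_cases hl : l = .nil
      · subst hl
        exact absurd (self_mem_treeFlags fun hr => hlr ⟨rfl, hr⟩) h'.2.2
      · exact Or.inl (ihl (self_mem_treeFlags hl) h'.2.1)
    · exact Or.inl (ihl h h'.2.1)
    · exact Or.inr (ihr h h'.2.2)

theorem treeGrow_treeTrim
    (h : skip (i + 1) o ≤ i → i < skip (i + 1) o + T.numLeaves →
      i ∈ treeTerminalFlags (skip (i + 1) o) T) :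
    treeGrow i o (treeTrim i (skip (i + 1) o) T) = T := by
  induction T generalizing o with
  | nil =>
    refine if_neg ?_
    rintro rfl
    simp [skip, BinaryTree.numLeaves, treeTerminalFlags] at h
  | node _ l r ihl ihr =>
    rw [BinaryTree.numLeaves, treeTerminalFlags] at h
    rw [treeTrim]
    split_ifs at h ⊢ with hlr ho
    · obtain ⟨rfl, rfl⟩ := hlr
      rw [treeGrow, if_pos (by grind [skip])]
    · obtain ⟨rfl, rfl⟩ := hlr
      simp only [BinaryTree.numLeaves, Set.mem_singleton_iff] at h
      rw [treeGrow, treeGrow, treeGrow, if_neg, if_neg] <;> grind [skip, BinaryTree.numLeaves]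
    · have hl : treeGrow i o (treeTrim i (skip (i + 1) o) l) = l := ihl fun h₁ h₂ =>
        (h h₁ (by omega)).resolve_right fun hr => by
          have := mem_treeFlags (mem_treeFlags_of_mem_treeTerminalFlags hr)
          omega
      have hoff := skip_add_numLeaves_treeGrow i o (treeTrim i (skip (i + 1) o) l)
      rw [hl] at hoff
      rw [treeGrow, hl, hoff, ihr]
      rw [← hoff]
      refine fun h₁ h₂ => (h (by omega) (by omega)).resolve_left fun hl => ?_
      have := mem_treeFlags (mem_treeFlags_of_mem_treeTerminalFlags hl)
      omega

end Trees

namespace IndexedForest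

variable (F : IndexedForest) {i : ℕ}

theorem firstLeaf_succ (k : ℕ) : F.firstLeaf (k + 1) = F.firstLeaf k + (F.trees k).numLeaves :=
  Finset.sum_range_succ _ _

theorem firstLeaf_strictMono : StrictMono F.firstLeaf := strictMono_nat_of_lt_succ fun k => by
  rw [firstLeaf_succ]
  exact Nat.lt_add_of_pos_right (F.trees k).numLeaves_pos

theorem existsUnique_tree (i : ℕ) :
    ∃! k, F.firstLeaf k ≤ i ∧ i < F.firstLeaf k + (F.trees k).numLeaves := by
  simp only [← firstLeaf_succ]
  refine existsUnique_of_exists_of_unique ?_ fun k l hk hl => ?_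
  · induction i with
    | zero => exact ⟨0, Nat.zero_le _, F.firstLeaf_strictMono Nat.one_pos⟩
    | succ i ih =>
      obtain ⟨k, hk, hk'⟩ := ih
      have := F.firstLeaf_strictMono (k + 1).lt_add_one
      rcases lt_or_ge (i + 1) (F.firstLeaf (k + 1)) with h | h
      · exact ⟨k, by omega, h⟩
      · exact ⟨k + 1, h, by omega⟩
  · have h₁ := F.firstLeaf_strictMono.lt_iff_lt.1 (hk.1.trans_lt hl.2)
    have h₂ := F.firstLeaf_strictMono.lt_iff_lt.1 (hl.1.trans_lt hk.2)
    omega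

theorem exists_forall_trees_eq_nil : ∃ N, ∀ k, N ≤ k → F.trees k = .nil := by
  obtain ⟨N, hN⟩ := F.finite_nontrivial.bddAbove
  exact ⟨N + 1, fun k hk => not_not.1 fun h => absurd (hN h) (by omega)⟩

/-- The multiset of the values `ρ_F(v)` over all the internal nodes `v` of `F`; it encodes the code
of `F`, as the multiplicity of `i` in it is `F.code i`. -/
def flags : Multiset ℕ :=
  ∑ k ∈ F.finite_nontrivial.toFinset, treeFlags (F.firstLeaf k) (F.trees k)

theorem flags_eq_sum_range {N : ℕ} (hN : ∀ k, N ≤ k → F.trees k = .nil) :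
    F.flags = ∑ k ∈ Finset.range N, treeFlags (F.firstLeaf k) (F.trees k) := by
  refine Finset.sum_subset (fun k hk => ?_) fun k _ hk => ?_
  · rw [Set.Finite.mem_toFinset] at hk
    exact Finset.mem_range.2 (not_le.1 fun h => hk (hN k h))
  · rw [Set.Finite.mem_toFinset, Set.mem_ofPred_eq, not_not] at hk
    rw [hk, treeFlags]

theorem mem_flags : i ∈ F.flags ↔ ∃ k, i ∈ treeFlags (F.firstLeaf k) (F.trees k) := by
  rw [flags, Multiset.mem_sum]
  refine exists_congr fun k => and_iff_right_of_imp fun hk => ?_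
  rw [Set.Finite.mem_toFinset]
  intro h
  rw [h] at hk
  exact Multiset.notMem_zero i hk

theorem count_flags (i : ℕ) : F.flags.count i = F.code i := by
  obtain ⟨N, hN⟩ := F.exists_forall_trees_eq_nil
  rw [F.flags_eq_sum_range fun k hk => hN k (le_of_max_le_left hk), Multiset.count_sum', code]
  refine (Finset.sum_subset (Finset.range_mono (le_max_right N (i + 1))) fun k _ hk => ?_).symm
  refine Multiset.count_eq_zero.2 fun h => ?_
  have := F.firstLeaf_strictMono.le_apply (x := k)
  have := mem_treeFlags h
  exact hk (Finset.mem_range.2 (by omega))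

theorem flags_eq_zero_iff : F.flags = 0 ↔ F = empty := by
  refine ⟨fun h => ?_, ?_⟩
  · ext1
    funext k
    by_contra hk
    have : F.firstLeaf k ∈ F.flags := F.mem_flags.2 ⟨k, self_mem_treeFlags hk⟩
    exact Multiset.notMem_zero _ (h ▸ this)
  · rintro rfl
    exact Finset.sum_eq_zero fun k _ => rfl

/-- Turn leaf `i` of the forest into a terminal node; the inverse operation of `trim`. -/
def grow (i : ℕ) : IndexedForest where
  trees k := treeGrow i (F.firstLeaf k) (F.trees k)
  finite_nontrivial := by
    refine (F.finite_nontrivial.union (Set.finite_le_nat i)).subset fun k hk => ?_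
    by_contra! h
    obtain ⟨hnil, hki⟩ := not_or.1 h
    have := F.firstLeaf_strictMono.le_apply (x := k)
    refine hk ?_
    rw [not_not.1 hnil, treeGrow, if_neg fun hi => hki (this.trans_eq hi)]

theorem firstLeaf_grow (i k : ℕ) : (F.grow i).firstLeaf k = skip (i + 1) (F.firstLeaf k) := by
  induction k with
  | zero => rfl
  | succ k ih => rw [firstLeaf_succ, firstLeaf_succ, ih, grow, skip_add_numLeaves_treeGrow]

theorem flags_grow (i : ℕ) : (F.grow i).flags = graft F.flags i := by
  obtain ⟨N, hN⟩ := F.exists_forall_trees_eq_nil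
  obtain ⟨N', hN'⟩ := (F.grow i).exists_forall_trees_eq_nil
  obtain ⟨k, hk, huniq⟩ := F.existsUnique_tree i
  rw [F.flags_eq_sum_range (N := N + N' + k + 1) fun j hj => hN j (by omega),
    (F.grow i).flags_eq_sum_range (N := N + N' + k + 1) fun j hj => hN' j (by omega)]
  simp only [firstLeaf_grow]
  simp only [grow, treeFlags_treeGrow, Finset.sum_add_distrib]
  rw [Finset.sum_eq_single k (fun j _ hj => if_neg fun h => hj (huniq j h)) (by grind),
    if_pos hk, graft, ← Multiset.singleton_add, add_comm, ← Multiset.coe_mapAddMonoidHom, map_sum]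

variable {F}

theorem grow_trim (h : i ∈ F.qdes) : (F.trim i).grow i = F := by
  obtain ⟨k, hk⟩ := h
  have hrange := mem_treeFlags (mem_treeFlags_of_mem_treeTerminalFlags hk)
  have hmem (j : ℕ) (h₁ : F.firstLeaf j ≤ i) (h₂ : i < F.firstLeaf j + (F.trees j).numLeaves) :
      i ∈ treeTerminalFlags (F.firstLeaf j) (F.trees j) := by
    rwa [(F.existsUnique_tree i).unique ⟨h₁, h₂⟩ ⟨hrange.1, by omega⟩]
  have hgrow (j : ℕ) (hj : skip (i + 1) ((F.trim i).firstLeaf j) = F.firstLeaf j) :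
      treeGrow i ((F.trim i).firstLeaf j) ((F.trim i).trees j) = F.trees j := by
    have := treeGrow_treeTrim (o := (F.trim i).firstLeaf j) (hj ▸ hmem j)
    rwa [hj] at this
  have hfirst (j : ℕ) : skip (i + 1) ((F.trim i).firstLeaf j) = F.firstLeaf j := by
    induction j with
    | zero => rfl
    | succ j ih =>
      rw [firstLeaf_succ, firstLeaf_succ, ← skip_add_numLeaves_treeGrow, hgrow j ih, ih]
  ext1
  exact funext fun j => hgrow j (hfirst j)

theorem flags_eq_graft (h : i ∈ F.qdes) : F.flags = graft (F.trim i).flags i := by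
  rw [← flags_grow, grow_trim h]

theorem mem_qdes_iff : i ∈ F.qdes ↔ ∃ e, F.flags = graft e i := by
  refine ⟨fun h => ⟨_, flags_eq_graft h⟩, fun h => ?_⟩
  obtain ⟨hi, hi'⟩ := exists_eq_graft_iff.1 h
  obtain ⟨k, hk⟩ := F.mem_flags.1 hi
  exact ⟨k, mem_treeTerminalFlags_of_succ_notMem hk fun h => hi' (F.mem_flags.2 ⟨k, h⟩)⟩

theorem flags_injective : Function.Injective flags := by
  suffices H : ∀ c (F G : IndexedForest), F.flags = c → G.flags = c → F = G from
    fun F G h => H _ F G h rfl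
  intro c
  induction c using graft_induction with
  | zero => exact fun F G hF hG => (F.flags_eq_zero_iff.1 hF).trans (G.flags_eq_zero_iff.1 hG).symm
  | graft c i ih =>
    intro F G hF hG
    have hFi : i ∈ F.qdes := mem_qdes_iff.2 ⟨c, hF⟩
    have hGi : i ∈ G.qdes := mem_qdes_iff.2 ⟨c, hG⟩
    rw [← grow_trim hFi, ← grow_trim hGi, ih (F.trim i) (G.trim i)
      (graft_injective i ((flags_eq_graft hFi).symm.trans hF))
      (graft_injective i ((flags_eq_graft hGi).symm.trans hG))]

theorem flags_surjective : Function.Surjective flags := by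
  intro c
  induction c using graft_induction with
  | zero => exact ⟨empty, empty.flags_eq_zero_iff.2 rfl⟩
  | graft c i ih =>
    obtain ⟨F, rfl⟩ := ih
    exact ⟨F.grow i, F.flags_grow i⟩

theorem bijective_flags : Function.Bijective flags := ⟨flags_injective, flags_surjective⟩

end IndexedForest

/-! ### Double forest polynomials -/

section DoubleForest

variable {n : ℕ}

theorem omitT_forestPoly (i : ℕ) (c : Multiset ℕ) :
    omitT i (forestPoly tvar c) = forestPoly (tvar ∘ skip i) c := by
  rw [omitT, map_forestPoly]
  congr 1
  funext j
  simp [tvar, skip]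

theorem specializeZero_forestPoly (c : Multiset ℕ) :
    specializeZero (forestPoly tvar c) = forestPoly 0 c := by
  rw [specializeZero, map_forestPoly]
  congr 1
  funext j
  simp [tvar]

theorem isDoubleForestFamily_forestPoly :
    IsDoubleForestFamily fun F => forestPoly tvar F.flags where
  homogeneous F := ⟨_, forestPoly_mem_homogeneousTX C_X_mem_homogeneousTX F.flags⟩
  normalized_empty := by
    rw [evalXT, aeval_forestPoly, if_pos (IndexedForest.empty.flags_eq_zero_iff.2 rfl)]
  normalized F hF := by rw [evalXT, aeval_forestPoly, if_neg (mt F.flags_eq_zero_iff.1 hF)]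
  eope_of_mem F i hi := by
    rw [eope_eq_divDiff, omitT_forestPoly, IndexedForest.flags_eq_graft hi,
      divDiff_forestPoly_graft]
  eope_of_notMem F i hi := by
    rw [eope_eq_divDiff, divDiff_forestPoly_eq_zero _ (mt IndexedForest.mem_qdes_iff.2 hi)]

theorem IsDoubleForestFamily.eq_forestPoly {P : IndexedForest → PolyTX}
    (hP : IsDoubleForestFamily P) (F : IndexedForest) : P F = forestPoly tvar F.flags := by
  induction hc : F.flags.card using Nat.strong_induction_on generalizing F with
  | _ m ih =>
    have hQ := isDoubleForestFamily_forestPoly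
    refine ext_divDiff tvar ?_ fun i => ?_
    · by_cases hF : F = IndexedForest.empty
      · subst hF
        exact hP.normalized_empty.trans hQ.normalized_empty.symm
      · exact (hP.normalized F hF).trans (hQ.normalized F hF).symm
    rw [← eope_eq_divDiff, ← eope_eq_divDiff]
    by_cases hi : i ∈ F.qdes
    · rw [hP.eope_of_mem F i hi, hQ.eope_of_mem F i hi, ih _ _ (F.trim i) rfl]
      rw [← hc, IndexedForest.flags_eq_graft hi, card_graft]
      exact Nat.lt_succ_self _
    · rw [hP.eope_of_notMem F i hi, hQ.eope_of_notMem F i hi]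

theorem doubleForest_eq (F : IndexedForest) : doubleForest F = forestPoly tvar F.flags :=
  (Classical.epsilon_spec ⟨_, isDoubleForestFamily_forestPoly⟩ :
    IsDoubleForestFamily doubleForest).eq_forestPoly F

theorem code_eq_appendZeros_iff {F : IndexedForest} {c : Fin n → ℕ} :
    F.code = appendZeros c ↔ F.flags = padCode c := by
  simp only [Multiset.ext, F.count_flags, count_padCode, funext_iff]

theorem existsUnique_code_eq (c : Fin n → ℕ) : ∃! F : IndexedForest, F.code = appendZeros c := by
  simp only [code_eq_appendZeros_iff]
  exact IndexedForest.bijective_flags.existsUnique (padCode c)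

theorem flags_forestOf (c : Fin n → ℕ) : (forestOf c).flags = padCode c :=
  code_eq_appendZeros_iff.1 (Classical.epsilon_spec (existsUnique_code_eq c).exists)

theorem doubleFundamental_eq (c : Fin n → ℕ) :
    doubleFundamental c = forestPoly tvar (padCode c) := by
  rw [doubleFundamental, doubleForest_eq, flags_forestOf]

theorem specializeZero_doubleFundamental {c : Fin n → ℕ} (hc : c ∈ padded n) :
    specializeZero (doubleFundamental c) = fundamental c := by
  rw [doubleFundamental_eq, specializeZero_forestPoly, fundamental_eq_forestPoly hc]

theorem mem_zigzag_iff {F : IndexedForest} : F ∈ zigzag n ↔ IsZigzag n F.flags := by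
  simp only [isZigzag_iff, ← IndexedForest.mem_qdes_iff]
  rfl

theorem range_flags_zigzag (n : ℕ) :
    Set.range (fun F : zigzag n => F.1.flags) = {c | IsZigzag n c} := by
  ext c
  constructor
  · rintro ⟨F, rfl⟩
    exact mem_zigzag_iff.1 F.2
  · intro hc
    obtain ⟨F, rfl⟩ := IndexedForest.bijective_flags.surjective c
    exact ⟨⟨F, mem_zigzag_iff.2 hc⟩, rfl⟩

theorem range_padCode_padded (n : ℕ) :
    Set.range (fun c : padded n => padCode c.1) = {c | IsZigzag n c} := by
  ext c
  constructor
  · rintro ⟨c, rfl⟩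
    exact isZigzag_padCode.2 c.2
  · intro hc
    obtain ⟨c', hc', rfl⟩ := exists_padCode_eq hc
    exact ⟨⟨c', hc'⟩, rfl⟩

theorem image_doubleForest_zigzag (n : ℕ) :
    doubleForest '' zigzag n = doubleFundamental '' padded n := by
  have h := congrArg (forestPoly tvar '' ·)
    ((range_flags_zigzag n).trans (range_padCode_padded n).symm)
  simp only [← Set.range_comp, Function.comp_def, ← doubleForest_eq, ← doubleFundamental_eq] at h
  rwa [Set.image_eq_range, Set.image_eq_range]

end DoubleForest

/-! ### Bases of the equivariantly quasisymmetric polynomials -/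

section Bases

variable {n : ℕ}

theorem mem_eqsym_iff {f : PolyTX} :
    f ∈ eqsym n ↔ ∀ i, i + 1 ≠ n → divDiff (tvar i) i f = 0 := by
  constructor
  · rintro ⟨hsupp, hf⟩ i hi
    rcases hi.lt_or_gt with h | h
    · rw [divDiff_eq_zero_iff, ← rPlus_eq_insertAt, ← rMinus_eq_insertAt]
      exact hf i h
    · exact divDiff_eq_zero_of_supported _ (Nat.lt_succ_iff.1 h) hsupp
  · refine fun h => ⟨mem_supported_of_divDiff tvar fun i hi => h i (by omega), fun i hi => ?_⟩
    rw [rPlus_eq_insertAt, rMinus_eq_insertAt, ← divDiff_eq_zero_iff]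
    exact h i hi.ne

theorem mem_eqsym_iff_forestCoeff {f : PolyTX} :
    f ∈ eqsym n ↔ ∀ c, forestCoeff tvar c f ≠ 0 → IsZigzag n c := by
  rw [mem_eqsym_iff]
  constructor
  · refine fun hf c hc => isZigzag_iff.2 ?_
    rintro i ⟨e, rfl⟩
    by_contra hi
    rw [forestCoeff_graft, hf i hi, map_zero] at hc
    exact hc rfl
  · intro hf i hi
    refine eq_zero_of_forestCoeff_eq_zero (tvar ∘ skip i) fun e => ?_
    rw [← forestCoeff_graft]
    by_contra he
    exact hi (isZigzag_iff.1 (hf _ he) i ⟨e, rfl⟩)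

theorem toSubmodule_eqsym (n : ℕ) : Subalgebra.toSubmodule (eqsym n) =
    Submodule.span CoeffT (forestBasis tvar '' {c | IsZigzag n c}) := by
  ext f
  rw [Module.Basis.mem_span_image, Subalgebra.mem_toSubmodule, mem_eqsym_iff_forestCoeff]
  refine forall_congr' fun c => ?_
  rw [Finset.mem_coe, Finsupp.mem_support_iff, forestBasis_repr_apply]
  rfl

theorem exists_basis_eqsym {ι : Type*} {κ : ι → Multiset ℕ} (hκ : Function.Injective κ)
    (hrange : Set.range κ = {c | IsZigzag n c}) :
    ∃ b : Module.Basis ι CoeffT (eqsym n), ∀ x, (b x : PolyTX) = forestPoly tvar (κ x) := by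
  have hspan : Submodule.span CoeffT (Set.range (forestBasis tvar ∘ κ)) =
      Subalgebra.toSubmodule (eqsym n) := by
    rw [toSubmodule_eqsym, Set.range_comp, hrange]
  have hli := (forestBasis tvar).linearIndependent.comp κ hκ
  exact ⟨(Module.Basis.span hli).map (.ofEq _ _ hspan ≪≫ₗ (eqsym n).toSubmoduleEquiv), fun x =>
    (congrArg Subtype.val (Module.Basis.span_apply hli x)).trans (forestBasis_apply tvar (κ x))⟩

theorem exists_basis_zigzag (n : ℕ) : ∃ b : Module.Basis (zigzag n) CoeffT (eqsym n),
    ∀ F : zigzag n, (b F : PolyTX) = doubleForest F := by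
  simp only [doubleForest_eq]
  exact exists_basis_eqsym (IndexedForest.bijective_flags.injective.comp Subtype.val_injective)
    (range_flags_zigzag n)

theorem exists_basis_padded (n : ℕ) : ∃ b : Module.Basis (padded n) CoeffT (eqsym n),
    ∀ c : padded n, (b c : PolyTX) = doubleFundamental (c : Fin n → ℕ) := by
  simp only [doubleFundamental_eq]
  exact exists_basis_eqsym (padCode_injective.comp Subtype.val_injective)
    (range_padCode_padded n)

end Bases

end EQSymPoly

end

theorem theorem4p9 :
    (∃! P : IndexedForest → PolyTX, IsDoubleForestFamily P) ∧
    ∀ n : ℕ,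
      (∀ c ∈ padded n, ∃! F : IndexedForest, F.code = appendZeros c) ∧
      (∀ c ∈ padded n, specializeZero (doubleFundamental c) = fundamental c) ∧
      doubleForest '' zigzag n = doubleFundamental '' padded n ∧
      (∃ b : Module.Basis (zigzag n) CoeffT (eqsym n),
        ∀ F : zigzag n, (b F : PolyTX) = doubleForest F) ∧
      (∃ b : Module.Basis (padded n) CoeffT (eqsym n),
        ∀ c : padded n, (b c : PolyTX) = doubleFundamental (c : Fin n → ℕ)) :=
  ⟨⟨_, isDoubleForestFamily_forestPoly, fun _ hP => funext hP.eq_forestPoly⟩, fun n =>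
    ⟨fun c _ => existsUnique_code_eq c, fun _ => specializeZero_doubleFundamental,
      image_doubleForest_zigzag n, exists_basis_zigzag n, exists_basis_padded n⟩⟩
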